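/- Let $r>1$ be an integer and let $\varphi,\psi\in L^1(\mathbb{R})$ be real-valued, with $\varphi$ bounded on $\mathbb{R}$ and $\psi$ bounded in a neighbourhood of the origin. For $\nu\in\mathbb{N}_0$ put $$m_\nu(\varphi,u)=\sum_{k\in\mathbb{Z}}\varphi(u-k)(k-u)^\nu,\qquad \widetilde m_\nu(\psi)=\int_{\mathbb{R}}u^\nu\psi(u)\,du .$$ Assume that $m_0(\varphi,u)=1$ for all $u\in\mathbb{R}$ and $\widetilde m_0(\psi)=1$; that $M_0(\psi):=\sup_{u\in\mathbb{R}}\sum_{k\in\mathbb{Z}}|\psi(u-k)|<+\infty$; that (i) for $\nu=1,\dots,r$ the moment $m_\nu(\varphi,u)=:m_\nu(\varphi)$ does not depend on $u$ (and $m_0(\varphi):=1$); (ii) $\sum_{\nu=0}^{i}\binom{i}{\nu}m_{i-\nu}(\varphi)\,\widetilde m_\nu(\psi)=0$ for $i=1,\dots,r-1$. For $w>0$ consider the Durrmeyer sampling operator $$(D_w^{\varphi,\psi}f)(x)=\sum_{k\in\mathbb{Z}}\varphi(wx-k)\,w\int_{\mathbb{R}}\psi(wu-k)f(u)\,du .$$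 Notation, for $1\le p<\infty$ (functions being identified when they agree almost everywhere). Let $\Delta^n_tf(x)=\sum_{j=0}^n\binom nj(-1)^{n-j}f(x+jt)$ and $\omega_n(f,\delta)_p=\sup_{|t|\le\delta}\|\Delta_t^nf\|_p$. For $\alpha>0$, $Lip^*(\alpha,L^p)$ is the set of $f\in L^p(\mathbb{R})$ with $\omega_{\lfloor\alpha\rfloor+1}(f,\delta)_p=O(\delta^\alpha)$ as $\delta\to0^+$. $W^{r,p}(\mathbb{R})$ is the set of $f\in L^p(\mathbb{R})$ with $f,\dots,f^{(r-1)}$ locally absolutely continuous and $f^{(r)}\in L^p(\mathbb{R})$. $Lip(r,L^p)$ is the set of $f\in L^p(\mathbb{R})$ with $f,\dots,f^{(r-2)}$ locally absolutely continuous, $f^{(r-1)}\in L^p(\mathbb{R})$ and $\omega_1(f^{(r-1)},\delta)_p=O(\delta)$ as $\delta\to0^+$. $W^{r-1}(BV)$ is the set of functions $f$ of bounded variation on $\mathbb{R}$ with $f,\dots,f^{(r-2)}$ locally absolutely continuous and $f^{(r-1)}$ (almost everywhere equal to a function) of bounded variation on $\mathbb{R}$. (a) Let $1<p<\infty$ and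 suppose that $\varphi(u)=O(|u|^{-\theta})$ and $\psi(u)=O(|u|^{-\theta})$ as $|u|\to+\infty$ for some $\theta>pr+1$. Then for every $f\in L^p(\mathbb{R})$ and $w>0$ the integrals and the series defining $D_w^{\varphi,\psi}f$ converge and $D_w^{\varphi,\psi}f\in L^p(\mathbb{R})$. If $f\in Lip^*(\alpha,L^p)$ with $0<\alpha<r$, then $$\|D_w^{\varphi,\psi}f-f\|_p=O(w^{-\alpha}),\qquad w\to+\infty ,$$ and if $f\in Lip(r,L^p)$ or $f\in W^{r,p}(\mathbb{R})$, then $\|D_w^{\varphi,\psi}f-f\|_p=O(w^{-r})$ as $w\to+\infty$. (b) Let $p=1$ and suppose that $\varphi(u)=O(|u|^{-\theta})$ as $|u|\to+\infty$ for some $\theta>r+1$, and that $\psi$ has compact support. Then for every $f\in L^1(\mathbb{R})$ and $w>0$ the integrals and the series defining $D_w^{\varphi,\psi}f$ converge and $D_w^{\varphi,\psi}f\in L^1(\mathbb{R})$. If $f\in Lip^*(\alpha,L^1)$ with $0<\alpha<r$, then $$\|D_w^{\varphi,\psi}f-f\|_1=O(w^{-\alpha}),\qquad w\to+\infty ,$$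 and if $f\in Lip(r,L^1)$ or $f\in W^{r-1}(BV)\cap L^1(\mathbb{R})$, then $\|D_w^{\varphi,\psi}f-f\|_1=O(w^{-r})$ as $w\to+\infty$. -/

import Mathlib

open MeasureTheory Filter Topology

noncomputable section

namespace Durrmeyer

/-- The discrete algebraic moment `m_ν(φ, u) = ∑_{k ∈ ℤ} φ(u - k) (k - u)^ν`. -/
def discreteMoment (φ : ℝ → ℝ) (ν : ℕ) (u : ℝ) : ℝ :=
  ∑' k : ℤ, φ (u - k) * ((k : ℝ) - u) ^ ν

/-- The continuous algebraic moment `∫ u^ν ψ(u) du`. -/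
def continuousMoment (ψ : ℝ → ℝ) (ν : ℕ) : ℝ :=
  ∫ u : ℝ, u ^ ν * ψ u

/-- The discrete absolute moment of order zero, `M_0(ξ) = sup_u ∑_{k ∈ ℤ} |ξ(u - k)|`. -/
def absMomentZero (ξ : ℝ → ℝ) : ENNReal :=
  ⨆ u : ℝ, ∑' k : ℤ, ENNReal.ofReal |ξ (u - k)|

/-- Discrete kernels: `φ ∈ L¹(ℝ)` is bounded and `∑_k φ(u - k) = 1` for every `u`. -/
structure IsDiscreteKernel (φ : ℝ → ℝ) : Prop where
  integrable : Integrable φ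
  bounded : ∃ C : ℝ, ∀ u, |φ u| ≤ C
  moment_zero : ∀ u, discreteMoment φ 0 u = 1

/-- Continuous kernels: `ψ ∈ L¹(ℝ)` is bounded near the origin and `∫ ψ = 1`. -/
structure IsContinuousKernel (ψ : ℝ → ℝ) : Prop where
  integrable : Integrable ψ
  bounded_near_zero : ∃ C : ℝ, ∀ᶠ u in 𝓝 (0 : ℝ), |ψ u| ≤ C
  moment_zero : continuousMoment ψ 0 = 1

/-- The condition `ξ(u) = O(|u|^{-θ})` as `|u| → ∞`. -/
def DecaysWithOrder (ξ : ℝ → ℝ) (θ : ℝ) : Prop :=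
  ξ =O[cocompact ℝ] fun u : ℝ => |u| ^ (-θ)

/-- The discrete moments of order `1, …, r` do not depend on the point. -/
def ConstantMoments (φ : ℝ → ℝ) (r : ℕ) : Prop :=
  ∀ ν ∈ Finset.Icc 1 r, ∀ u v : ℝ, discreteMoment φ ν u = discreteMoment φ ν v

/-- The vanishing moment condition
`∑_{ν ≤ i} (i choose ν) m_{i-ν}(φ) m̃_ν(ψ) = 0` for `i = 1, …, r - 1`. -/
def VanishingMoments (φ ψ : ℝ → ℝ) (r : ℕ) : Prop :=
  ∀ i : ℕ, 1 ≤ i → i < r → ∀ u : ℝ,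
    ∑ ν ∈ Finset.range (i + 1),
      (i.choose ν : ℝ) * discreteMoment φ (i - ν) u * continuousMoment ψ ν = 0

/-- The coefficient `w ∫ ψ(wu - k) f(u) du`. -/
def coeff (ψ : ℝ → ℝ) (w : ℝ) (f : ℝ → ℝ) (k : ℤ) : ℝ :=
  w * ∫ u : ℝ, ψ (w * u - k) * f u

/-- The Durrmeyer sampling operator
`(D_w f)(x) = ∑_{k ∈ ℤ} φ(wx - k) w ∫ ψ(wu - k) f(u) du`. -/
def durrmeyer (φ ψ : ℝ → ℝ) (w : ℝ) (f : ℝ → ℝ) (x : ℝ) : ℝ :=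
  ∑' k : ℤ, φ (w * x - k) * coeff ψ w f k

/-- All integrals and series defining `D_w f` converge, and `D_w f ∈ L^p(ℝ)`. -/
def WellDefinedOn (φ ψ : ℝ → ℝ) (p : ENNReal) (f : ℝ → ℝ) : Prop :=
  ∀ w : ℝ, 0 < w →
    (∀ k : ℤ, Integrable fun u : ℝ => ψ (w * u - k) * f u) ∧
    (∀ x : ℝ, Summable fun k : ℤ => φ (w * x - k) * coeff ψ w f k) ∧
    MemLp (durrmeyer φ ψ w f) p volume

/-- `‖D_w f - f‖_p = O(w^{-β})` as `w → +∞`. -/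
def HasRate (φ ψ : ℝ → ℝ) (p : ENNReal) (β : ℝ) (f : ℝ → ℝ) : Prop :=
  ∃ C w₀ : ℝ, 0 < w₀ ∧ ∀ w : ℝ, w₀ ≤ w →
    eLpNorm (fun x => durrmeyer φ ψ w f x - f x) p volume ≤ ENNReal.ofReal (C * w ^ (-β))

/-- The finite difference `Δ_t^n(f, x) = ∑_{j ≤ n} (n choose j) (-1)^{n-j} f(x + jt)`. -/
def finiteDiff (n : ℕ) (t : ℝ) (f : ℝ → ℝ) (x : ℝ) : ℝ :=
  ∑ j ∈ Finset.range (n + 1), (n.choose j : ℝ) * (-1) ^ (n - j) * f (x + j * t)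

/-- The modulus of smoothness `ω_n(f, δ)_p = sup_{|t| ≤ δ} ‖Δ_t^n f‖_p`. -/
def modulus (n : ℕ) (p : ENNReal) (f : ℝ → ℝ) (δ : ℝ) : ENNReal :=
  ⨆ (t : ℝ) (_ : |t| ≤ δ), eLpNorm (finiteDiff n t f) p volume

/-- `f ∈ L^p(ℝ)` and `ω_n(f, δ)_p = O(δ^α)` as `δ → 0+`. -/
def ModulusBigO (n : ℕ) (α : ℝ) (p : ENNReal) (f : ℝ → ℝ) : Prop :=
  MemLp f p volume ∧ ∃ C δ₀ : ℝ, 0 < δ₀ ∧ ∀ δ : ℝ, 0 < δ → δ ≤ δ₀ →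
    modulus n p f δ ≤ ENNReal.ofReal (C * δ ^ α)

/-- The generalized Lipschitz space `Lip*(α, L^p)`, `α > 0`: the modulus has order
`⌊α⌋ + 1`, the smallest integer greater than `α`. -/
def MemLipStar (α : ℝ) (p : ENNReal) (f : ℝ → ℝ) : Prop :=
  ModulusBigO (⌊α⌋₊ + 1) α p f

/-- `g, g', …, g^{(s-1)}` are locally absolutely continuous on `ℝ`. (This forces `g` to be of
class `C^{s-1}` and `g^{(s)}` to exist almost everywhere.) -/
def LocACDerivs (s : ℕ) (g : ℝ → ℝ) : Prop :=
  ∀ i < s, ∀ a b : ℝ, AbsolutelyContinuousOnInterval (iteratedDeriv i g) a b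

/-- The Sobolev space `W^{s,p}(ℝ)`; functions are identified when they agree almost everywhere. -/
def MemSobolev (s : ℕ) (p : ENNReal) (f : ℝ → ℝ) : Prop :=
  MemLp f p volume ∧ ∃ g : ℝ → ℝ, g =ᵐ[volume] f ∧ LocACDerivs s g ∧
    MemLp (iteratedDeriv s g) p volume

/-- The space `W^s(BV)`; functions are identified when they agree almost everywhere. In
particular `g^{(s)}`, which is only defined almost everywhere, has to agree almost everywhere
with a function of bounded variation. -/
def MemSobolevBV (s : ℕ) (f : ℝ → ℝ) : Prop :=
  ∃ g : ℝ → ℝ, g =ᵐ[volume] f ∧ BoundedVariationOn g Set.univ ∧ LocACDerivs s g ∧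
    ∃ h : ℝ → ℝ, h =ᵐ[volume] iteratedDeriv s g ∧ BoundedVariationOn h Set.univ

/-- The space `Lip(s + β, L^p) = W^s Lip(β, L^p)`, `0 < β ≤ 1`: the derivative of order `s` is
in `Lip(β, L^p)`, the space given by the modulus of order one. -/
def MemLip (s : ℕ) (β : ℝ) (p : ENNReal) (f : ℝ → ℝ) : Prop :=
  MemLp f p volume ∧ ∃ g : ℝ → ℝ, g =ᵐ[volume] f ∧ LocACDerivs s g ∧
    ModulusBigO 1 β p (iteratedDeriv s g)

end Durrmeyer

end

/-!
The proof rests on one estimate. For a finite `p ≥ 1` and kernels with decay of order greater than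
`r + 1` there is a constant `K` such that `‖D_w f - f‖_p ≤ K ω_r(f, 1/w)_p` for every `f ∈ L^p` and
`w > 0` (`exists_eLpNorm_durrmeyer_one_sub_le` for `w = 1`, and
`eLpNorm_durrmeyer_sub_le` in general by dilation). The rates follow because membership in each of
the spaces of the theorem implies `ω_r(f, δ)_p = O(δ^β)` with the right `β`
(the lemmas named `modulusBigO`): for `Lip*` one compares moduli of different orders; for the other
spaces `Δ_t g` is written as the integral of `g'` over an interval of length `|t|`, which bounds
`‖Δ_t^{n+s} g‖_p` by `|t|^s ‖Δ_t^n g^{(s)}‖_p`, and in the case of bounded variation one adds that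
`‖Δ_t h‖_1 ≤ |t| Var(h)`.

For `w = 1`, the two decay conditions give `∑_k |φ(x - k) ψ(u - k)| ≤ B (1 + |u - x|)^{-θ}`
with `θ > r + 1` (`exists_tsum_kernel_le`), so `D_1` is dominated by a convolution whose kernel has
`r` finite absolute moments. By the moment conditions `D_1` maps `(· - x)^n`, `n < r`, to a function
whose value at `x` is `1` for `n = 0` and `0` otherwise (`durrmeyer_pow`). Given `f`, a combination
`g` of iterated Steklov means satisfies `‖f - g‖_p ≤ ω_r(f, 1)_p` and
`‖g^{(r)}‖_p ≤ C ω_r(f, 1)_p` (`eLpNorm_sub_smoothing_le`, `eLpNorm_smoothing_le`). Since `D_1`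
reproduces the Taylor polynomial of `g` at `x`, the error `|D_1 f(x) - f(x)|` is at most
`|f(x) - g(x)|` plus the weighted averages of `|f - g|` and of the Taylor remainder of `g`
(`enorm_durrmeyer_sub_le`); all norms are then estimated by Minkowski's integral inequality
(`eLpNorm_lintegral_le`).
-/

open scoped ENNReal NNReal

namespace Durrmeyer

/-! ### Minkowski's integral inequality -/

section Minkowski

variable {α β : Type*} [MeasurableSpace α] [MeasurableSpace β] {μ : Measure α} {κ : Measure β}
  [SFinite μ] [SFinite κ] {p : ℝ≥0∞}

/-- Minkowski's integral inequality, in the case where the norms of the sections are uniformly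
bounded: Hölder's inequality in `κ` followed by Tonelli's theorem. -/
theorem eLpNorm_lintegral_le (hp : 1 ≤ p) (hp' : p ≠ ⊤)
    {F : α → β → ℝ≥0∞} (hF : Measurable (Function.uncurry F)) {A : ℝ≥0∞}
    (hA : ∀ᵐ v ∂κ, eLpNorm (fun x => F x v) p μ ≤ A) :
    eLpNorm (fun x => ∫⁻ v, F x v ∂κ) p μ ≤ κ Set.univ * A := by
  have hp0 : p ≠ 0 := (zero_lt_one.trans_le hp).ne'
  obtain ⟨q, rfl⟩ : ∃ q : ℝ, p = ENNReal.ofReal q := ⟨p.toReal, (ENNReal.ofReal_toReal hp').symm⟩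
  have hq : 1 ≤ q := by simpa using hp
  have hq0 : 0 < q := by linarith
  have hnorm : ∀ G : α → ℝ≥0∞,
      eLpNorm G (ENNReal.ofReal q) μ = (∫⁻ x, G x ^ q ∂μ) ^ (1 / q) := by
    intro G
    rw [eLpNorm_eq_lintegral_rpow_enorm_toReal hp0 hp', ENNReal.toReal_ofReal hq0.le]
    rfl
  have hHolder : ∀ x, (∫⁻ v, F x v ∂κ) ^ q ≤ (∫⁻ v, F x v ^ q ∂κ) * κ Set.univ ^ (q - 1) := by
    intro x
    have h := eLpNorm'_le_eLpNorm'_mul_rpow_measure_univ (μ := κ) (f := F x) one_pos hq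
      (hF.comp measurable_prodMk_left).aestronglyMeasurable
    simp only [eLpNorm', enorm_eq_self, ENNReal.rpow_one, div_one] at h
    calc (∫⁻ v, F x v ∂κ) ^ q
        ≤ ((∫⁻ v, F x v ^ q ∂κ) ^ (1 / q) * κ Set.univ ^ (1 - 1 / q)) ^ q := by gcongr
      _ = _ := by
        rw [ENNReal.mul_rpow_of_nonneg _ _ hq0.le, ← ENNReal.rpow_mul, ← ENNReal.rpow_mul]
        congr 2
        · field_simp; simp
        · field_simp
  have hA' : ∀ᵐ v ∂κ, ∫⁻ x, F x v ^ q ∂μ ≤ A ^ q := by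
    filter_upwards [hA] with v hv
    rw [hnorm] at hv
    calc ∫⁻ x, F x v ^ q ∂μ = ((∫⁻ x, F x v ^ q ∂μ) ^ (1 / q)) ^ q := by
          rw [← ENNReal.rpow_mul, one_div_mul_cancel hq0.ne', ENNReal.rpow_one]
      _ ≤ A ^ q := by gcongr
  have hmeas : Measurable fun x => ∫⁻ v, F x v ^ q ∂κ := (hF.pow_const q).lintegral_prod_right'
  rw [hnorm]
  calc (∫⁻ x, (∫⁻ v, F x v ∂κ) ^ q ∂μ) ^ (1 / q)
      ≤ (∫⁻ x, (∫⁻ v, F x v ^ q ∂κ) * κ Set.univ ^ (q - 1) ∂μ) ^ (1 / q) := by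
        gcongr with x; exact hHolder x
    _ = ((∫⁻ v, ∫⁻ x, F x v ^ q ∂μ ∂κ) * κ Set.univ ^ (q - 1)) ^ (1 / q) := by
        rw [lintegral_mul_const _ hmeas,
          lintegral_lintegral_swap (hF.pow_const q).aemeasurable]
    _ ≤ ((A ^ q * κ Set.univ) * κ Set.univ ^ (q - 1)) ^ (1 / q) := by
        gcongr
        exact (lintegral_mono_ae hA').trans (lintegral_const _).le
    _ = ((κ Set.univ * A) ^ q) ^ (1 / q) := by
        congr 1
        rw [ENNReal.mul_rpow_of_nonneg _ _ hq0.le, mul_assoc, mul_comm]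
        congr 1
        nth_rw 1 [← ENNReal.rpow_one (κ Set.univ)]
        rw [← ENNReal.rpow_add_of_nonneg _ _ zero_le_one (by linarith)]
        congr 1; ring
    _ = κ Set.univ * A := by
        rw [← ENNReal.rpow_mul, mul_one_div_cancel hq0.ne', ENNReal.rpow_one]

theorem eLpNorm_le_of_enorm_le_lintegral (hp : 1 ≤ p) (hp' : p ≠ ⊤) {h : α → ℝ}
    {F : α → β → ℝ} (hF : Measurable (Function.uncurry F)) {A : ℝ≥0∞}
    (hh : ∀ x, ‖h x‖ₑ ≤ ∫⁻ v, ‖F x v‖ₑ ∂κ)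
    (hA : ∀ᵐ v ∂κ, eLpNorm (fun x => F x v) p μ ≤ A) :
    eLpNorm h p μ ≤ κ Set.univ * A := by
  refine le_trans ?_ (eLpNorm_lintegral_le (μ := μ) (κ := κ) hp hp' (F := fun x v => ‖F x v‖ₑ)
    hF.enorm (A := A) ?_)
  · exact eLpNorm_mono_enorm fun x => by simpa using hh x
  · filter_upwards [hA] with v hv
    rwa [eLpNorm_enorm]

end Minkowski

/-! ### Finite differences and moduli of smoothness -/

section FiniteDifferences

variable {p : ℝ≥0∞}

theorem eLpNorm_comp_add_right {f : ℝ → ℝ} (hf : AEStronglyMeasurable f volume) (c : ℝ) :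
    eLpNorm (fun x => f (x + c)) p volume = eLpNorm f p volume :=
  eLpNorm_comp_measurePreserving hf (measurePreserving_add_right volume c)

/-- The sum defining the finite difference is the iterated forward difference. -/
theorem finiteDiff_eq_fwdDiff_iter (n : ℕ) (t : ℝ) (f : ℝ → ℝ) :
    finiteDiff n t f = (fwdDiff t)^[n] f := by
  ext x
  rw [fwdDiff_iter_eq_sum_shift, finiteDiff]
  refine Finset.sum_congr rfl fun j _ => ?_
  simp [mul_comm]

@[simp] theorem finiteDiff_zero (t : ℝ) (f : ℝ → ℝ) : finiteDiff 0 t f = f := by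
  simp [finiteDiff_eq_fwdDiff_iter]

theorem finiteDiff_one (t : ℝ) (f : ℝ → ℝ) (x : ℝ) : finiteDiff 1 t f x = f (x + t) - f x := by
  simp [finiteDiff_eq_fwdDiff_iter, fwdDiff]

theorem finiteDiff_succ (n : ℕ) (t : ℝ) (f : ℝ → ℝ) (x : ℝ) :
    finiteDiff (n + 1) t f x = finiteDiff n t f (x + t) - finiteDiff n t f x := by
  rw [finiteDiff_eq_fwdDiff_iter, finiteDiff_eq_fwdDiff_iter, Function.iterate_succ_apply', fwdDiff]

theorem finiteDiff_succ' (n : ℕ) (t : ℝ) (f : ℝ → ℝ) :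
    finiteDiff (n + 1) t f = finiteDiff n t (fun x => f (x + t) - f x) := by
  rw [finiteDiff_eq_fwdDiff_iter, finiteDiff_eq_fwdDiff_iter, Function.iterate_succ_apply]
  rfl

theorem measurable_finiteDiff {f : ℝ → ℝ} (hf : Measurable f) (n : ℕ) (t : ℝ) :
    Measurable (finiteDiff n t f) := by
  unfold finiteDiff
  fun_prop

theorem finiteDiff_congr_ae {f g : ℝ → ℝ} (h : f =ᵐ[volume] g) (n : ℕ) (t : ℝ) :
    finiteDiff n t f =ᵐ[volume] finiteDiff n t g := by
  have : ∀ᵐ x : ℝ, ∀ j : ℕ, f (x + j * t) = g (x + j * t) :=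
    ae_all_iff.2 fun j =>
      (measurePreserving_add_right volume ((j : ℝ) * t)).quasiMeasurePreserving.ae_eq_comp h
  filter_upwards [this] with x hx
  simp only [finiteDiff, hx]

theorem modulus_congr_ae {f g : ℝ → ℝ} (h : f =ᵐ[volume] g) (n : ℕ) (δ : ℝ) :
    modulus n p f δ = modulus n p g δ := by
  unfold modulus
  exact iSup_congr fun t => iSup_congr fun _ => eLpNorm_congr_ae (finiteDiff_congr_ae h n t)

theorem eLpNorm_finiteDiff_le_modulus (n : ℕ) (f : ℝ → ℝ) {t δ : ℝ} (h : |t| ≤ δ) :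
    eLpNorm (finiteDiff n t f) p volume ≤ modulus n p f δ :=
  le_iSup₂ (f := fun (t : ℝ) (_ : |t| ≤ δ) => eLpNorm (finiteDiff n t f) p volume) t h

theorem eLpNorm_finiteDiff_add_le (hp : 1 ≤ p) {f : ℝ → ℝ} (hf : Measurable f) (n m : ℕ) (t : ℝ) :
    eLpNorm (finiteDiff (n + m) t f) p volume ≤ 2 ^ m * eLpNorm (finiteDiff n t f) p volume := by
  induction m with
  | zero => simp
  | succ m ih =>
    have hm := measurable_finiteDiff hf (n + m) t
    have : finiteDiff (n + (m + 1)) t f =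
        (fun x => finiteDiff (n + m) t f (x + t)) - finiteDiff (n + m) t f :=
      funext fun x => finiteDiff_succ (n + m) t f x
    rw [this]
    calc _ ≤ eLpNorm (fun x => finiteDiff (n + m) t f (x + t)) p volume
          + eLpNorm (finiteDiff (n + m) t f) p volume :=
          eLpNorm_sub_le (hm.comp (measurable_add_const t)).aestronglyMeasurable
            hm.aestronglyMeasurable hp
      _ = 2 * eLpNorm (finiteDiff (n + m) t f) p volume := by
          rw [eLpNorm_comp_add_right hm.aestronglyMeasurable, two_mul]
      _ ≤ 2 * (2 ^ m * eLpNorm (finiteDiff n t f) p volume) := by gcongr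
      _ = _ := by rw [pow_succ]; ring

theorem modulus_le_of_le (hp : 1 ≤ p) {f : ℝ → ℝ} (hf : AEStronglyMeasurable f volume) {n m : ℕ}
    (hnm : n ≤ m) (δ : ℝ) : modulus m p f δ ≤ 2 ^ (m - n) * modulus n p f δ := by
  obtain ⟨g, hg, hfg⟩ := hf
  rw [modulus_congr_ae hfg, modulus_congr_ae hfg]
  obtain ⟨k, rfl⟩ := Nat.exists_eq_add_of_le hnm
  refine iSup₂_le fun t ht => ?_
  rw [Nat.add_sub_cancel_left]
  exact (eLpNorm_finiteDiff_add_le hp hg.measurable n k t).trans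
    (by gcongr; exact eLpNorm_finiteDiff_le_modulus n g ht)

end FiniteDifferences

/-! ### Averages of translates -/

section Averages

variable {p : ℝ≥0∞}

theorem enorm_intervalIntegral_le (G : ℝ → ℝ) (a b : ℝ) :
    ‖∫ s in a..b, G s‖ₑ ≤ ∫⁻ s in Set.uIoc a b, ‖G s‖ₑ := by
  refine le_trans (le_of_eq ?_) (enorm_integral_le_lintegral_enorm _)
  rw [← ofReal_norm, ← ofReal_norm, intervalIntegral.norm_intervalIntegral_eq]

theorem eLpNorm_intervalIntegral_le (hp : 1 ≤ p) (hp' : p ≠ ⊤) {F : ℝ → ℝ → ℝ}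
    (hF : Measurable (Function.uncurry F)) (a b : ℝ) {A : ℝ≥0∞}
    (hA : ∀ s ∈ Set.uIoc a b, eLpNorm (fun x => F x s) p volume ≤ A) :
    eLpNorm (fun x => ∫ s in a..b, F x s) p volume ≤ ENNReal.ofReal |b - a| * A := by
  have h := eLpNorm_le_of_enorm_le_lintegral (μ := (volume : Measure ℝ))
    (κ := volume.restrict (Set.uIoc a b)) hp hp' hF
    (h := fun x => ∫ s in a..b, F x s) (fun x => enorm_intervalIntegral_le _ a b)
    ((ae_restrict_iff' measurableSet_uIoc).2 (.of_forall hA))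
  rwa [Measure.restrict_apply_univ, Real.volume_uIoc] at h

theorem eLpNorm_average_le (hp : 1 ≤ p) (hp' : p ≠ ⊤) {D : ℝ → ℝ} (hD : Measurable D)
    (a b c : ℝ) :
    eLpNorm (fun x => ∫ s in a..b, D (x + c * s)) p volume
      ≤ ENNReal.ofReal |b - a| * eLpNorm D p volume :=
  eLpNorm_intervalIntegral_le hp hp' (F := fun x s => D (x + c * s))
    (hD.comp (by fun_prop)) a b fun s _ =>
      (eLpNorm_comp_add_right hD.aestronglyMeasurable (c * s)).le

theorem finiteDiff_intervalIntegral (n : ℕ) (t : ℝ) {G : ℝ → ℝ → ℝ} {a b : ℝ}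
    (hG : ∀ x, IntervalIntegrable (G x) volume a b) (x : ℝ) :
    finiteDiff n t (fun y => ∫ s in a..b, G y s) x
      = ∫ s in a..b, finiteDiff n t (fun y => G y s) x := by
  simp only [finiteDiff]
  rw [intervalIntegral.integral_finsetSum fun j _ => (hG _).const_mul _]
  simp only [intervalIntegral.integral_const_mul]

theorem finiteDiff_comp_add (n : ℕ) (t : ℝ) (f : ℝ → ℝ) (c x : ℝ) :
    finiteDiff n t (fun y => f (y + c)) x = finiteDiff n t f (x + c) := by
  simp only [finiteDiff, add_right_comm]

end Averages

/-! ### Moduli of smoothness in the function spaces -/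

section Smoothness

variable {p : ℝ≥0∞}

theorem eLpNorm_finiteDiff_succ_le_deriv (hp : 1 ≤ p) (hp' : p ≠ ⊤) {g : ℝ → ℝ}
    (hg : ∀ a b, AbsolutelyContinuousOnInterval g a b) (n : ℕ) (t : ℝ) :
    eLpNorm (finiteDiff (n + 1) t g) p volume
      ≤ ENNReal.ofReal |t| * eLpNorm (finiteDiff n t (deriv g)) p volume := by
  have hint : ∀ x, IntervalIntegrable (fun s => deriv g (x + s)) volume 0 t := fun x => by
    simpa using ((hg x (x + t)).intervalIntegrable_deriv).comp_add_left x
  have hFTC : (fun x => g (x + t) - g x) = fun x => ∫ s in 0..t, deriv g (x + s) := by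
    ext x
    rw [intervalIntegral.integral_comp_add_left, add_zero, (hg x (x + t)).integral_deriv_eq_sub]
  have hd : finiteDiff (n + 1) t g = fun x => ∫ s in 0..t, finiteDiff n t (deriv g) (x + 1 * s) := by
    ext x
    rw [finiteDiff_succ', hFTC, finiteDiff_intervalIntegral n t hint]
    simp only [finiteDiff_comp_add, one_mul]
  rw [hd]
  simpa using eLpNorm_average_le hp hp' (measurable_finiteDiff (measurable_deriv g) n t) 0 t 1

/-- No integrability of the derivatives is assumed: the right side may be infinite. -/
theorem LocACDerivs.eLpNorm_finiteDiff_le (hp : 1 ≤ p) (hp' : p ≠ ⊤) {s : ℕ} {g : ℝ → ℝ}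
    (hg : LocACDerivs s g) (n : ℕ) (t : ℝ) :
    eLpNorm (finiteDiff (n + s) t g) p volume
      ≤ ENNReal.ofReal |t| ^ s * eLpNorm (finiteDiff n t (iteratedDeriv s g)) p volume := by
  induction s generalizing g with
  | zero => simp
  | succ s ih =>
    have hg0 : ∀ a b, AbsolutelyContinuousOnInterval g a b := by simpa using hg 0 s.succ_pos
    have hg' : LocACDerivs s (deriv g) := fun i hi a b => by
      rw [← iteratedDeriv_succ']
      exact hg (i + 1) (by omega) a b
    calc _ ≤ ENNReal.ofReal |t| * eLpNorm (finiteDiff (n + s) t (deriv g)) p volume :=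
          eLpNorm_finiteDiff_succ_le_deriv hp hp' hg0 (n + s) t
      _ ≤ ENNReal.ofReal |t| * (ENNReal.ofReal |t| ^ s *
            eLpNorm (finiteDiff n t (iteratedDeriv s (deriv g))) p volume) := by
          gcongr; exact ih hg'
      _ = _ := by rw [iteratedDeriv_succ', pow_succ']; ring

/-- The increments of `h` along the progression `x + ℤ t` add up to at most its variation. -/
theorem tsum_edist_le_eVariationOn (h : ℝ → ℝ) (x : ℝ) {t : ℝ} (ht : 0 ≤ t) :
    ∑' n : ℤ, edist (h (x + n * t + t)) (h (x + n * t)) ≤ eVariationOn h Set.univ := by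
  refine ENNReal.summable.tsum_le_of_sum_le fun S => ?_
  obtain ⟨N, hN⟩ : ∃ N : ℕ, ∀ n ∈ S, -(N : ℤ) ≤ n ∧ n < N := by
    refine ⟨S.sup Int.natAbs + 1, fun n hn => ?_⟩
    have := Finset.le_sup (f := Int.natAbs) hn
    omega
  let u : ℕ → ℝ := fun i => x + ((i : ℤ) - N : ℤ) * t
  have hu : Monotone u := fun i j hij => by
    simp only [u, Int.cast_sub]
    gcongr
  have hsub : S ⊆ (Finset.range (2 * N)).image fun i : ℕ => (i : ℤ) - N := fun n hn => by
    have := hN n hn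
    exact Finset.mem_image.2 ⟨(n + N).toNat, by simp; omega, by omega⟩
  calc _ ≤ _ := Finset.sum_le_sum_of_subset hsub
    _ = ∑ i ∈ Finset.range (2 * N), edist (h (u (i + 1))) (h (u i)) := by
      rw [Finset.sum_image fun i _ j _ hij => by simpa using hij]
      refine Finset.sum_congr rfl fun i _ => ?_
      simp only [u]
      congr 2
      push_cast
      ring
    _ ≤ _ := eVariationOn.sum_le hu fun _ => Set.mem_univ _

/-- Cutting `ℝ` into the translates of `(0, t]` turns `‖Δ_t h‖_1` into the integral over `(0, t]` of
the sums of increments of `h` along `x + ℤ t`. -/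
theorem eLpNorm_one_finiteDiff_one_le_eVariationOn {h : ℝ → ℝ}
    (hh : BoundedVariationOn h Set.univ) (t : ℝ) :
    eLpNorm (finiteDiff 1 t h) 1 volume ≤ ENNReal.ofReal |t| * eVariationOn h Set.univ := by
  -- A function of bounded variation is a difference of monotone functions.
  have hm : Measurable h := by
    obtain ⟨P, Q, hP, hQ, rfl⟩ :=
      hh.locallyBoundedVariationOn.exists_monotoneOn_sub_monotoneOn
    exact (monotoneOn_univ.1 hP).measurable.sub (monotoneOn_univ.1 hQ).measurable
  have hpos : ∀ t : ℝ, 0 < t →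
      eLpNorm (finiteDiff 1 t h) 1 volume ≤ ENNReal.ofReal |t| * eVariationOn h Set.univ := by
    intro t ht
    have hF : Measurable fun x => edist (h (x + t)) (h x) := by fun_prop
    have hmm : ∀ n : ℤ, Measurable fun x => edist (h (x + n * t + t)) (h (x + n * t)) :=
      fun n => hF.comp (measurable_add_const _)
    calc eLpNorm (finiteDiff 1 t h) 1 volume = ∫⁻ x, edist (h (x + t)) (h x) := by
          rw [eLpNorm_one_eq_lintegral_enorm]
          simp only [finiteDiff_one, edist_eq_enorm_sub]
      _ = ∑' g : AddSubgroup.zmultiples t, ∫⁻ x in Set.Ioc 0 (0 + t),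
            edist (h ((g +ᵥ x) + t)) (h (g +ᵥ x)) :=
          (isAddFundamentalDomain_Ioc ht 0).lintegral_eq_tsum''
            fun x => edist (h (x + t)) (h x)
      _ ≤ ∑' n : ℤ, ∫⁻ x in Set.Ioc 0 (0 + t), edist (h (x + n * t + t)) (h (x + n * t)) := by
          refine (ENNReal.tsum_le_tsum_comp_of_surjective
            (f := fun n : ℤ => (⟨n • t, n, rfl⟩ : AddSubgroup.zmultiples t)) ?_ _).trans
            (le_of_eq ?_)
          · rintro ⟨_, n, rfl⟩
            exact ⟨n, rfl⟩
          · refine tsum_congr fun n => ?_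
            simp [AddSubgroup.vadd_def, add_comm]
      _ = ∫⁻ x in Set.Ioc 0 (0 + t), ∑' n : ℤ, edist (h (x + n * t + t)) (h (x + n * t)) :=
          (lintegral_tsum fun n => (hmm n).aemeasurable).symm
      _ ≤ ∫⁻ x in Set.Ioc 0 (0 + t), eVariationOn h Set.univ :=
          lintegral_mono fun x => tsum_edist_le_eVariationOn h x ht.le
      _ = _ := by simp [abs_of_pos ht, mul_comm]
  rcases lt_trichotomy t 0 with ht | rfl | ht
  · have hd : finiteDiff 1 t h = - fun x => finiteDiff 1 (-t) h (x + t) := by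
      ext x; simp [finiteDiff_one]
    rw [hd, eLpNorm_neg,
      eLpNorm_comp_add_right (measurable_finiteDiff hm 1 (-t)).aestronglyMeasurable]
    simpa using hpos (-t) (by linarith)
  · have : finiteDiff 1 0 h = 0 := by ext x; simp [finiteDiff_one]
    simp [this]
  · exact hpos t ht

theorem MemLipStar.modulusBigO (hp : 1 ≤ p) {α : ℝ} {r : ℕ} (h0 : 0 < α) (hα : α < r) {f : ℝ → ℝ}
    (hf : MemLipStar α p f) : ModulusBigO r α p f := by
  obtain ⟨hfp, C, δ₀, hδ₀, h⟩ := hf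
  refine ⟨hfp, 2 ^ (r - (⌊α⌋₊ + 1)) * C, δ₀, hδ₀, fun δ hδ hδ' => ?_⟩
  have hle : ⌊α⌋₊ + 1 ≤ r := (Nat.floor_lt h0.le).2 hα
  calc modulus r p f δ ≤ 2 ^ (r - (⌊α⌋₊ + 1)) * modulus (⌊α⌋₊ + 1) p f δ :=
        modulus_le_of_le hp hfp.1 hle δ
    _ ≤ 2 ^ (r - (⌊α⌋₊ + 1)) * ENNReal.ofReal (C * δ ^ α) := by gcongr; exact h δ hδ hδ'
    _ = _ := by
        rw [mul_assoc, ENNReal.ofReal_mul (p := 2 ^ _) (by positivity),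
          ENNReal.ofReal_pow (by norm_num)]
        simp

theorem LocACDerivs.modulus_le (hp : 1 ≤ p) (hp' : p ≠ ⊤) {s : ℕ} {f g : ℝ → ℝ}
    (hgf : g =ᵐ[volume] f) (hg : LocACDerivs s g) (n : ℕ) (δ : ℝ) :
    modulus (n + s) p f δ ≤ ENNReal.ofReal δ ^ s * modulus n p (iteratedDeriv s g) δ := by
  rw [← modulus_congr_ae hgf]
  refine iSup₂_le fun t ht => (hg.eLpNorm_finiteDiff_le hp hp' n t).trans ?_
  gcongr
  exact eLpNorm_finiteDiff_le_modulus n _ ht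

theorem MemSobolev.modulusBigO (hp : 1 ≤ p) (hp' : p ≠ ⊤) {r : ℕ} {f : ℝ → ℝ}
    (hf : MemSobolev r p f) : ModulusBigO r r p f := by
  obtain ⟨hfp, g, hgf, hg, hr⟩ := hf
  refine ⟨hfp, (eLpNorm (iteratedDeriv r g) p volume).toReal, 1, one_pos, fun δ hδ _ => ?_⟩
  have h := hg.modulus_le hp hp' hgf 0 δ
  rw [zero_add] at h
  refine h.trans ?_
  rw [ENNReal.ofReal_mul (by positivity), ENNReal.ofReal_toReal hr.2.ne, Real.rpow_natCast,
    ENNReal.ofReal_pow hδ.le, mul_comm]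
  gcongr
  exact iSup₂_le fun t _ => by simp

theorem MemLip.modulusBigO (hp : 1 ≤ p) (hp' : p ≠ ⊤) {s : ℕ} {f : ℝ → ℝ}
    (hf : MemLip s 1 p f) : ModulusBigO (s + 1) (s + 1 : ℕ) p f := by
  obtain ⟨hfp, g, hgf, hg, -, C, δ₀, hδ₀, hs⟩ := hf
  refine ⟨hfp, C, δ₀, hδ₀, fun δ hδ hδ' => ?_⟩
  have h := hg.modulus_le hp hp' hgf 1 δ
  rw [add_comm] at h
  calc _ ≤ _ := h
    _ ≤ ENNReal.ofReal δ ^ s * ENNReal.ofReal (C * δ ^ (1 : ℝ)) := by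
        gcongr; exact hs δ hδ hδ'
    _ = _ := by
        rw [← ENNReal.ofReal_pow hδ.le, ← ENNReal.ofReal_mul (by positivity), Real.rpow_natCast,
          Real.rpow_one]
        congr 1
        ring

theorem MemSobolevBV.modulusBigO {s : ℕ} {f : ℝ → ℝ} (hf : MemSobolevBV s f)
    (hf1 : MemLp f 1 volume) : ModulusBigO (s + 1) (s + 1 : ℕ) 1 f := by
  obtain ⟨g, hgf, -, hg, b, hb, hbv⟩ := hf
  refine ⟨hf1, (eVariationOn b Set.univ).toReal, 1, one_pos, fun δ hδ _ => ?_⟩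
  have h := hg.modulus_le le_rfl ENNReal.one_ne_top hgf 1 δ
  rw [add_comm, ← modulus_congr_ae hb] at h
  have hmod : modulus 1 1 b δ ≤ ENNReal.ofReal δ * eVariationOn b Set.univ :=
    iSup₂_le fun t ht => (eLpNorm_one_finiteDiff_one_le_eVariationOn hbv t).trans (by gcongr)
  calc _ ≤ _ := h
    _ ≤ ENNReal.ofReal δ ^ s * (ENNReal.ofReal δ * eVariationOn b Set.univ) := by gcongr
    _ = _ := by
        rw [ENNReal.ofReal_mul (by positivity), ENNReal.ofReal_toReal hbv, Real.rpow_natCast,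
          ENNReal.ofReal_pow hδ.le, pow_succ]
        ring

end Smoothness

/-! ### Smoothing by Steklov means -/

section Steklov

variable {p : ℝ≥0∞}

/-- The Steklov mean `A_t f(x) = ∫₀¹ f(x + ts) ds`; `A_0` is the identity. -/
noncomputable def steklov (t : ℝ) (f : ℝ → ℝ) (x : ℝ) : ℝ :=
  ∫ s in (0 : ℝ)..1, f (x + t * s)

@[simp] theorem steklov_zero (f : ℝ → ℝ) : steklov 0 f = f := by
  ext x; simp [steklov]

theorem measurable_steklov {f : ℝ → ℝ} (hf : Measurable f) (t : ℝ) : Measurable (steklov t f) := by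
  have : StronglyMeasurable fun z : ℝ × ℝ => f (z.1 + t * z.2) :=
    (hf.comp (by fun_prop)).stronglyMeasurable
  change Measurable fun x => ∫ s in (0 : ℝ)..1, f (x + t * s)
  simpa only [intervalIntegral.integral_of_le zero_le_one] using
    (this.integral_prod_right' (ν := volume.restrict (Set.Ioc 0 1))).measurable

theorem steklov_eq {t : ℝ} (ht : t ≠ 0) (f : ℝ → ℝ) (x : ℝ) :
    steklov t f x = t⁻¹ * ∫ u in x..x + t, f u := by
  rw [steklov, intervalIntegral.integral_comp_add_mul _ ht]
  simp

theorem steklov_eq_sub {t : ℝ} (ht : t ≠ 0) {f : ℝ → ℝ}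
    (hf : ∀ a b, IntervalIntegrable f volume a b) :
    steklov t f = fun x => t⁻¹ * ((∫ u in 0..x + t, f u) - ∫ u in 0..x, f u) := by
  ext x
  rw [steklov_eq ht, intervalIntegral.integral_interval_sub_left (hf _ _) (hf _ _)]

theorem continuous_steklov {t : ℝ} (ht : t ≠ 0) {f : ℝ → ℝ}
    (hf : ∀ a b, IntervalIntegrable f volume a b) : Continuous (steklov t f) := by
  rw [steklov_eq_sub ht hf]
  have := intervalIntegral.continuous_primitive hf 0
  fun_prop

theorem intervalIntegrable_steklov {f : ℝ → ℝ} (hf : ∀ a b, IntervalIntegrable f volume a b)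
    (t a b : ℝ) : IntervalIntegrable (steklov t f) volume a b := by
  rcases eq_or_ne t 0 with rfl | ht
  · simpa using hf a b
  · exact (continuous_steklov ht hf).intervalIntegrable a b

theorem measurable_steklov_iterate {f : ℝ → ℝ} (hf : Measurable f) (t : ℝ) (m : ℕ) :
    Measurable ((steklov t)^[m] f) := by
  induction m with
  | zero => exact hf
  | succ m ih => rw [Function.iterate_succ_apply']; exact measurable_steklov ih t

theorem intervalIntegrable_steklov_iterate {f : ℝ → ℝ}
    (hf : ∀ a b, IntervalIntegrable f volume a b) (t : ℝ) (m : ℕ) (a b : ℝ) :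
    IntervalIntegrable ((steklov t)^[m] f) volume a b := by
  induction m generalizing a b with
  | zero => exact hf a b
  | succ m ih => rw [Function.iterate_succ_apply']; exact intervalIntegrable_steklov ih t a b

theorem continuous_steklov_iterate_succ {t : ℝ} (ht : t ≠ 0) {f : ℝ → ℝ}
    (hf : ∀ a b, IntervalIntegrable f volume a b) (m : ℕ) :
    Continuous ((steklov t)^[m + 1] f) := by
  rw [Function.iterate_succ_apply']
  exact continuous_steklov ht (intervalIntegrable_steklov_iterate hf t m)

/-- `(A_t f)' = t⁻¹ Δ_t f`. -/
theorem hasDerivAt_steklov {t : ℝ} (ht : t ≠ 0) {f : ℝ → ℝ} (hf : Continuous f) (x : ℝ) :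
    HasDerivAt (steklov t f) (t⁻¹ * (f (x + t) - f x)) x := by
  have hd : ∀ y, HasDerivAt (fun y => ∫ u in 0..y, f u) (f y) y := fun y =>
    intervalIntegral.integral_hasDerivAt_right (hf.intervalIntegrable _ _)
      hf.stronglyMeasurable.stronglyMeasurableAtFilter hf.continuousAt
  rw [steklov_eq_sub ht fun a b => hf.intervalIntegrable a b]
  exact (((hd (x + t)).comp_add_const x t).sub (hd x)).const_mul _

theorem hasDerivAt_finiteDiff_steklov {t : ℝ} (ht : t ≠ 0) {f : ℝ → ℝ} (hf : Continuous f)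
    (n : ℕ) (x : ℝ) :
    HasDerivAt (finiteDiff n t (steklov t f)) (t⁻¹ * finiteDiff (n + 1) t f x) x := by
  have h := HasDerivAt.fun_sum (u := Finset.range (n + 1)) fun j _ =>
    (((hasDerivAt_steklov ht hf (x + j * t)).comp_add_const x (j * t)).const_mul
      ((n.choose j : ℝ) * (-1) ^ (n - j)))
  refine HasDerivAt.congr_deriv h ?_
  rw [finiteDiff_succ', finiteDiff, Finset.mul_sum]
  exact Finset.sum_congr rfl fun j _ => by ring

/-- `Δ_t^n` commutes with the Steklov mean, which is an average of translates. -/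
theorem eLpNorm_finiteDiff_steklov_le (hp : 1 ≤ p) (hp' : p ≠ ⊤) {f : ℝ → ℝ} (hfm : Measurable f)
    (hf : ∀ a b, IntervalIntegrable f volume a b) (n : ℕ) (t : ℝ) :
    eLpNorm (finiteDiff n t (steklov t f)) p volume ≤ eLpNorm (finiteDiff n t f) p volume := by
  have hint : ∀ x, IntervalIntegrable (fun s => f (x + t * s)) volume 0 1 := fun x => by
    rcases eq_or_ne t 0 with rfl | ht
    · simp
    · have := ((hf (x + t * 0) (x + t * 1)).comp_add_left x).comp_mul_left (c := t)
      simpa [ht] using this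
  have hd : finiteDiff n t (steklov t f) =
      fun x => ∫ s in (0 : ℝ)..1, finiteDiff n t f (x + t * s) := by
    ext x
    change finiteDiff n t (fun y => ∫ s in (0 : ℝ)..1, f (y + t * s)) x = _
    rw [finiteDiff_intervalIntegral n t hint]
    simp only [finiteDiff_comp_add]
  rw [hd]
  simpa using eLpNorm_average_le hp hp' (measurable_finiteDiff hfm n t) 0 1 t

/-- The finite difference `Δ_σ^r f` with the value `f(x + jσ)` replaced by that of the `m`-fold
Steklov mean of `f` with step `jh`. As the step is proportional to `j`, replacing `σ` by `σ + hs`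
and averaging over `s ∈ [0, 1]` raises `m` by one. -/
noncomputable def steklovDiff (r m : ℕ) (h : ℝ) (f : ℝ → ℝ) (σ x : ℝ) : ℝ :=
  ∑ j ∈ Finset.range (r + 1),
    (r.choose j : ℝ) * (-1) ^ (r - j) * (steklov (j * h))^[m] f (x + j * σ)

/-- The identity `A_{jh}^{m+1} f(x + jσ) = ∫₀¹ A_{jh}^m f(x + j(σ + hs)) ds` for every `j` at once. -/
theorem steklovDiff_succ (r m : ℕ) (h : ℝ) {f : ℝ → ℝ}
    (hf : ∀ a b, IntervalIntegrable f volume a b) (σ x : ℝ) :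
    steklovDiff r (m + 1) h f σ x = ∫ s in (0 : ℝ)..1, steklovDiff r m h f (σ + h * s) x := by
  have hint : ∀ j : ℕ, IntervalIntegrable
      (fun s => (steklov (j * h))^[m] f (x + j * (σ + h * s))) volume 0 1 := by
    intro j
    have hj := intervalIntegrable_steklov_iterate hf (j * h) m
    rcases eq_or_ne (j * h) 0 with h0 | h0
    · have : ∀ s : ℝ, x + j * (σ + h * s) = x + j * σ := fun s => by
        linear_combination s * h0
      simp [this]
    · have := ((hj (x + j * σ + (j * h) * 0) (x + j * σ + (j * h) * 1)).comp_add_left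
        (x + j * σ)).comp_mul_left (c := j * h)
      have h1 : j * h * 1 / (j * h) = 1 := by rw [mul_one, div_self h0]
      simp only [add_sub_cancel_left, mul_zero, zero_div, h1] at this
      refine this.congr_ae (.of_forall fun s => ?_)
      exact congrArg ((steklov (j * h))^[m] f) (by ring)
  simp only [steklovDiff]
  rw [intervalIntegral.integral_finsetSum fun j _ => (hint j).const_mul _]
  refine Finset.sum_congr rfl fun j _ => ?_
  rw [intervalIntegral.integral_const_mul, Function.iterate_succ_apply', steklov]
  congr 1
  refine intervalIntegral.integral_congr fun s _ => ?_
  exact congrArg ((steklov (j * h))^[m] f) (by ring)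

/-- Averaging reduces to `m = 0`, where the sum is `Δ_τ^r f` with `τ ∈ [σ, σ + mh]`. -/
theorem eLpNorm_steklovDiff_le (hp : 1 ≤ p) (hp' : p ≠ ⊤) {f : ℝ → ℝ} (hfm : Measurable f)
    (hf : ∀ a b, IntervalIntegrable f volume a b) (r m : ℕ) {h δ : ℝ} (hh : 0 ≤ h) {σ : ℝ}
    (hσ : 0 ≤ σ) (hσδ : σ + m * h ≤ δ) :
    eLpNorm (steklovDiff r m h f σ) p volume ≤ modulus r p f δ := by
  induction m generalizing σ with
  | zero =>
    have : steklovDiff r 0 h f σ = finiteDiff r σ f := rfl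
    rw [this]
    exact eLpNorm_finiteDiff_le_modulus r f (by rw [abs_of_nonneg hσ]; simpa using hσδ)
  | succ m ih =>
    have : steklovDiff r (m + 1) h f σ =
        fun x => ∫ s in (0 : ℝ)..1, steklovDiff r m h f (σ + h * s) x :=
      funext (steklovDiff_succ r m h hf σ)
    rw [this]
    have hmeas : Measurable (Function.uncurry fun x s => steklovDiff r m h f (σ + h * s) x) := by
      unfold steklovDiff Function.uncurry
      refine Finset.measurable_sum _ fun j _ => Measurable.const_mul ?_ _
      exact (measurable_steklov_iterate hfm _ m).comp (by fun_prop)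
    have := eLpNorm_intervalIntegral_le hp hp' hmeas 0 1 (A := modulus r p f δ) fun s hs => ?_
    · simpa using this
    · rw [Set.uIoc_of_le zero_le_one] at hs
      refine ih (by nlinarith [hs.1]) ?_
      push_cast at hσδ
      nlinarith [hs.2]

/-- The `i`-th derivative, `i ≤ r`, of the combination
`∑_{j = 1}^r (-1)^{j + 1} (r choose j) A_{jh}^{r + 1} f` of iterated Steklov means. It is written
down explicitly: differentiating `A_t` gives `t⁻¹ Δ_t`. The summation index is `j - 1`, and the
value for `i > r` has no meaning. -/
noncomputable def smoothing (r : ℕ) (h : ℝ) (f : ℝ → ℝ) (i : ℕ) (x : ℝ) : ℝ :=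
  ∑ j ∈ Finset.range r, (-1) ^ j * (r.choose (j + 1) : ℝ) * (((j + 1 : ℕ) * h)⁻¹) ^ i *
    finiteDiff i ((j + 1 : ℕ) * h) ((steklov ((j + 1 : ℕ) * h))^[r + 1 - i] f) x

theorem step_ne_zero {h : ℝ} (hh : 0 < h) (j : ℕ) : ((j + 1 : ℕ) : ℝ) * h ≠ 0 := by
  positivity

theorem measurable_smoothing {f : ℝ → ℝ} (hf : Measurable f) (r : ℕ) (h : ℝ) (i : ℕ) :
    Measurable (smoothing r h f i) := by
  unfold smoothing
  exact Finset.measurable_sum _ fun j _ =>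
    (measurable_finiteDiff (measurable_steklov_iterate hf _ _) _ _).const_mul _

/-- One Steklov mean is used up by each derivative. -/
theorem hasDerivAt_smoothing {f : ℝ → ℝ} (hf : ∀ a b, IntervalIntegrable f volume a b) {r : ℕ}
    {h : ℝ} (hh : 0 < h) {i : ℕ} (hi : i < r) (x : ℝ) :
    HasDerivAt (smoothing r h f i) (smoothing r h f (i + 1) x) x := by
  obtain ⟨m, rfl⟩ : ∃ m, r = i + 1 + m := ⟨r - (i + 1), by omega⟩
  have e1 : i + 1 + m + 1 - i = m + 1 + 1 := by omega
  have e2 : i + 1 + m + 1 - (i + 1) = m + 1 := by omega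
  have := HasDerivAt.fun_sum (u := Finset.range (i + 1 + m)) fun j _ =>
    (hasDerivAt_finiteDiff_steklov (step_ne_zero hh j)
      (continuous_steklov_iterate_succ (step_ne_zero hh j) hf m) i x).const_mul
      ((-1) ^ j * ((i + 1 + m).choose (j + 1) : ℝ) * (((j + 1 : ℕ) * h)⁻¹) ^ i)
  unfold smoothing
  simp only [e1, e2, Function.iterate_succ_apply' _ (m + 1)]
  refine HasDerivAt.congr_deriv this ?_
  exact Finset.sum_congr rfl fun j _ => by rw [pow_succ]; ring

theorem continuous_smoothing {f : ℝ → ℝ} (hf : ∀ a b, IntervalIntegrable f volume a b) (r : ℕ)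
    {h : ℝ} (hh : 0 < h) : Continuous (smoothing r h f r) := by
  unfold smoothing finiteDiff
  have : ∀ j : ℕ, Continuous ((steklov ((j + 1 : ℕ) * h))^[r + 1 - r] f) := fun j => by
    rw [Nat.add_sub_cancel_left]
    exact continuous_steklov_iterate_succ (step_ne_zero hh j) hf 0
  fun_prop

/-- The `r`-th derivative consists of the terms `(jh)^{-r} Δ_{jh}^r A_{jh} f`. -/
theorem eLpNorm_smoothing_le (hp : 1 ≤ p) (hp' : p ≠ ⊤) (r : ℕ) {h : ℝ} (hh : 0 < h)
    {f : ℝ → ℝ} (hfm : Measurable f)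
    (hf : ∀ a b, IntervalIntegrable f volume a b) {δ : ℝ} (hδ : r * h ≤ δ) :
    eLpNorm (smoothing r h f r) p volume ≤
      (∑ j ∈ Finset.range r,
        ‖(-1) ^ j * (r.choose (j + 1) : ℝ) * (((j + 1 : ℕ) * h)⁻¹) ^ r‖ₑ) * modulus r p f δ := by
  have he : smoothing r h f r = ∑ j ∈ Finset.range r,
      ((-1) ^ j * (r.choose (j + 1) : ℝ) * (((j + 1 : ℕ) * h)⁻¹) ^ r) •
        finiteDiff r ((j + 1 : ℕ) * h) (steklov ((j + 1 : ℕ) * h) f) := by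
    ext x
    simp [smoothing, Finset.sum_apply]
  rw [he, Finset.sum_mul]
  refine (eLpNorm_sum_le (fun j _ => ?_) hp).trans (Finset.sum_le_sum fun j hj => ?_)
  · exact ((measurable_finiteDiff (measurable_steklov hfm _) _ _).const_smul _).aestronglyMeasurable
  · rw [eLpNorm_const_smul]
    gcongr
    refine (eLpNorm_finiteDiff_steklov_le hp hp' hfm hf r _).trans
      (eLpNorm_finiteDiff_le_modulus r f ?_)
    rw [abs_of_pos (by positivity)]
    have : ((j + 1 : ℕ) : ℝ) ≤ r := by exact_mod_cast Finset.mem_range.1 hj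
    exact (by gcongr : _ ≤ r * h).trans hδ

/-- The term `j = 0` of `steklovDiff r (r + 1) h f 0` is `± f`, and the other terms form the
smoothing. -/
theorem eLpNorm_sub_smoothing_le (hp : 1 ≤ p) (hp' : p ≠ ⊤) (r : ℕ) {h : ℝ} (hh : 0 ≤ h)
    {f : ℝ → ℝ} (hfm : Measurable f)
    (hf : ∀ a b, IntervalIntegrable f volume a b) {δ : ℝ} (hδ : (r + 1 : ℕ) * h ≤ δ) :
    eLpNorm (f - smoothing r h f 0) p volume ≤ modulus r p f δ := by
  have he : f - smoothing r h f 0 = (-1 : ℝ) ^ r • steklovDiff r (r + 1) h f 0 := by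
    ext x
    have h1 : ∀ m : ℕ, (steklov 0)^[m] f = f := fun m => by
      induction m with
      | zero => rfl
      | succ m ih => rw [Function.iterate_succ_apply', ih, steklov_zero]
    simp only [Pi.sub_apply, Pi.smul_apply, smul_eq_mul, steklovDiff, Finset.sum_range_succ',
      smoothing, mul_add, Finset.mul_sum]
    have hsq : (-1 : ℝ) ^ r * (-1) ^ r = 1 := by rw [← mul_pow]; simp
    have h2 : (-1 : ℝ) ^ r * ((r.choose 0 : ℝ) * (-1) ^ (r - 0) *
        (steklov ((0 : ℕ) * h))^[r + 1] f (x + (0 : ℕ) * 0)) = f x := by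
      simp only [Nat.cast_zero, zero_mul, h1, add_zero, Nat.choose_zero_right, Nat.cast_one,
        Nat.sub_zero, one_mul]
      rw [← mul_assoc, hsq, one_mul]
    rw [h2, sub_eq_add_neg, add_comm, ← Finset.sum_neg_distrib]
    congr 1
    refine Finset.sum_congr rfl fun j hj => ?_
    obtain ⟨k, rfl⟩ : ∃ k, r = j + 1 + k := ⟨r - (j + 1), by have := Finset.mem_range.1 hj; omega⟩
    have h3 : (-1 : ℝ) ^ (j + 1 + k) * (-1) ^ (j + 1 + k - (j + 1)) = - (-1) ^ j := by
      rw [Nat.add_sub_cancel_left, pow_add, mul_assoc, ← mul_pow]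
      simp [pow_succ]
    simp only [pow_zero, mul_one, finiteDiff_zero, Nat.sub_zero, mul_zero, add_zero]
    linear_combination (-((j + 1 + k).choose (j + 1) : ℝ) *
      (steklov ((j + 1 : ℕ) * h))^[j + 1 + k + 1] f x) * h3
  rw [he, eLpNorm_const_smul]
  simpa using eLpNorm_steklovDiff_le hp hp' hfm hf r (r + 1) hh le_rfl (by simpa using hδ)

end Steklov

/-! ### The Taylor remainder -/

section Taylor

/-- Induction on the order: the derivative in `v` of the remainder is the remainder of one order less
for `G 1`, and the mean value inequality applies. The constant `1 / r!` is not needed. -/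
theorem abs_taylor_remainder_le {r : ℕ} {G : ℕ → ℝ → ℝ}
    (hG : ∀ i < r + 1, ∀ x, HasDerivAt (G i) (G (i + 1) x) x) (hc : Continuous (G (r + 1)))
    (x v : ℝ) :
    |G 0 (x + v) - ∑ i ∈ Finset.range (r + 1), G i x * (v ^ i / i.factorial)|
      ≤ |v| ^ r * |(∫ u in x..x + v, |G (r + 1) u|)| := by
  induction r generalizing G v with
  | zero =>
    have := intervalIntegral.integral_eq_sub_of_hasDerivAt (a := x) (b := x + v)
      (fun y _ => hG 0 one_pos y) (hc.intervalIntegrable _ _)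
    simp only [zero_add] at this ⊢
    simp only [Finset.sum_range_one, pow_zero, Nat.factorial_zero, Nat.cast_one, div_one, mul_one,
      one_mul, ← this]
    exact intervalIntegral.norm_integral_le_abs_integral_norm (f := G 1) (a := x) (b := x + v)
  | succ r ih =>
    have hder : ∀ y, HasDerivAt
        (fun y => G 0 (x + y) - ∑ i ∈ Finset.range (r + 1 + 1), G i x * (y ^ i / i.factorial))
        (G 1 (x + y) - ∑ i ∈ Finset.range (r + 1), G (i + 1) x * (y ^ i / i.factorial)) y := by
      intro y
      refine ((hG 0 (by omega) (x + y)).comp_const_add x y).sub ?_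
      simp only [Finset.sum_range_succ' _ (r + 1), pow_zero]
      refine HasDerivAt.add_const _ (HasDerivAt.fun_sum fun i _ => ?_)
      refine HasDerivAt.const_mul _ ?_
      convert (hasDerivAt_pow (i + 1) y).div_const ((i + 1).factorial : ℝ) using 1
      rw [Nat.factorial_succ]
      push_cast
      field_simp
    have hbound : ∀ y ∈ Set.uIcc 0 v,
        ‖G 1 (x + y) - ∑ i ∈ Finset.range (r + 1), G (i + 1) x * (y ^ i / i.factorial)‖
          ≤ |v| ^ r * |(∫ u in x..x + v, |G (r + 1 + 1) u|)| := by
      intro y hy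
      have hyv : |y| ≤ |v| := by simpa using Set.abs_sub_left_of_mem_uIcc hy
      have h1 := ih (G := fun i => G (i + 1)) (fun i hi => hG (i + 1) (by omega)) hc y
      refine h1.trans (mul_le_mul (pow_le_pow_left₀ (abs_nonneg y) hyv r) ?_ (abs_nonneg _)
        (by positivity))
      refine intervalIntegral.abs_integral_mono_interval ?_ (.of_forall fun _ => abs_nonneg _)
        (hc.abs.intervalIntegrable _ _)
      rcases le_total 0 v with h | h
      · rw [Set.uIcc_of_le h] at hy
        rw [Set.uIoc_of_le (by linarith [hy.1]), Set.uIoc_of_le (by linarith)]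
        exact Set.Ioc_subset_Ioc_right (by linarith [hy.2])
      · rw [Set.uIcc_of_ge h] at hy
        rw [Set.uIoc_of_ge (by linarith [hy.2]), Set.uIoc_of_ge (by linarith)]
        exact Set.Ioc_subset_Ioc_left (by linarith [hy.1])
    have := (convex_uIcc 0 v).norm_image_sub_le_of_norm_hasDerivWithin_le
      (fun y _ => (hder y).hasDerivWithinAt) hbound Set.left_mem_uIcc Set.right_mem_uIcc
    simp only [Finset.sum_range_succ' _ (r + 1), pow_zero] at this ⊢
    simp only [add_zero, zero_pow (Nat.succ_ne_zero _), zero_div, mul_zero, Finset.sum_const_zero,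
      Nat.factorial_zero, Nat.cast_one, div_one, mul_one, zero_add, sub_self, sub_zero,
      Real.norm_eq_abs] at this ⊢
    refine this.trans (le_of_eq ?_)
    rw [pow_succ]
    ring

theorem enorm_taylor_remainder_le {r : ℕ} (hr : 1 ≤ r) {G : ℕ → ℝ → ℝ}
    (hG : ∀ i < r, ∀ x, HasDerivAt (G i) (G (i + 1) x) x) (hc : Continuous (G r)) (x v : ℝ) :
    ‖G 0 (x + v) - ∑ i ∈ Finset.range r, G i x * (v ^ i / i.factorial)‖ₑ
      ≤ ENNReal.ofReal (|v| ^ r) * ∫⁻ s in Set.Ioc 0 1, ‖G r (x + v * s)‖ₑ := by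
  obtain ⟨r, rfl⟩ := Nat.exists_eq_add_of_le' hr
  have h1 : ∫ u in x..x + v, |G (r + 1) u| = v * ∫ s in (0 : ℝ)..1, |G (r + 1) (x + v * s)| := by
    rw [intervalIntegral.mul_integral_comp_add_mul (f := fun u => |G (r + 1) u|)]
    simp
  have h2 : ENNReal.ofReal (∫ s in (0 : ℝ)..1, |G (r + 1) (x + v * s)|)
      = ∫⁻ s in Set.Ioc 0 1, ‖G (r + 1) (x + v * s)‖ₑ := by
    rw [intervalIntegral.integral_of_le zero_le_one, ofReal_integral_eq_lintegral_ofReal]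
    · simp only [Real.enorm_eq_ofReal_abs]
    · have : Continuous fun s => |G (r + 1) (x + v * s)| := by fun_prop
      exact (this.intervalIntegrable 0 1).1
    · exact .of_forall fun _ => abs_nonneg _
  have h0 : 0 ≤ ∫ s in (0 : ℝ)..1, |G (r + 1) (x + v * s)| :=
    intervalIntegral.integral_nonneg zero_le_one fun _ _ => abs_nonneg _
  rw [← h2, ← ENNReal.ofReal_mul (by positivity), Real.enorm_eq_ofReal_abs]
  refine ENNReal.ofReal_le_ofReal ((abs_taylor_remainder_le hG hc x v).trans (le_of_eq ?_))
  rw [h1, abs_mul, abs_of_nonneg h0, pow_succ]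
  ring

end Taylor

/-! ### Polynomially decaying weights -/

section Decay

/-- The model weight `(1 + |v|)^{-θ}`. -/
noncomputable def decay (θ v : ℝ) : ℝ := (1 + |v|) ^ (-θ)

theorem decay_pos (θ v : ℝ) : 0 < decay θ v := by unfold decay; positivity

theorem continuous_decay (θ : ℝ) : Continuous (decay θ) := by
  unfold decay
  exact (by fun_prop : Continuous fun v : ℝ => 1 + |v|).rpow_const
    fun v => Or.inl (by positivity)

theorem decay_le_one {θ : ℝ} (hθ : 0 ≤ θ) (v : ℝ) : decay θ v ≤ 1 :=
  Real.rpow_le_one_of_one_le_of_nonpos (by simp) (by linarith)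

theorem decay_le_mul {θ : ℝ} (hθ : 0 ≤ θ) {a b c : ℝ} (hc : 0 < c)
    (h : 1 + |b| ≤ c * (1 + |a|)) : decay θ a ≤ c ^ θ * decay θ b := by
  have h0 : 0 < 1 + |b| := by positivity
  calc decay θ a ≤ ((1 + |b|) / c) ^ (-θ) :=
        Real.rpow_le_rpow_of_nonpos (by positivity) (by rwa [div_le_iff₀' hc]) (by linarith)
    _ = c ^ θ * decay θ b := by
        rw [Real.div_rpow h0.le hc.le, Real.rpow_neg hc.le, div_inv_eq_mul, mul_comm, decay]

theorem abs_pow_mul_decay_le (θ v : ℝ) (n : ℕ) : |v| ^ n * decay θ v ≤ decay (θ - n) v := by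
  have h0 : 0 < 1 + |v| := by positivity
  calc |v| ^ n * decay θ v ≤ (1 + |v|) ^ n * decay θ v := by
        have := decay_pos θ v
        gcongr
        linarith
    _ = decay (θ - n) v := by
        rw [decay, decay, ← Real.rpow_natCast, ← Real.rpow_add h0]
        congr 1
        ring

theorem integrable_decay {θ : ℝ} (hθ : 1 < θ) : Integrable (decay θ) := by
  have := integrable_one_add_norm (E := ℝ) (μ := volume) (r := θ) (by simpa using hθ)
  exact this

theorem summable_decay_int {θ : ℝ} (hθ : 1 < θ) : Summable fun k : ℤ => decay θ k := by
  refine Summable.of_norm_bounded_eventually (Real.summable_abs_int_rpow hθ) ?_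
  -- The term `k = 0` is excluded: there `|k| ^ (-θ)` is `0`.
  filter_upwards [(Set.finite_singleton (0 : ℤ)).compl_mem_cofinite] with k hk
  have hk0 : 0 < |(k : ℝ)| := abs_pos.2 (by exact_mod_cast hk)
  rw [Real.norm_of_nonneg (decay_pos _ _).le]
  exact Real.rpow_le_rpow_of_nonpos hk0 (by linarith) (by linarith)

theorem exists_tsum_decay_le {θ : ℝ} (hθ : 1 < θ) :
    ∃ S : ℝ, 0 ≤ S ∧ ∀ y : ℝ, Summable (fun k : ℤ => decay θ (y - k)) ∧
      ∑' k : ℤ, decay θ (y - k) ≤ S := by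
  have hs := (summable_decay_int hθ).mul_left ((2 : ℝ) ^ θ)
  refine ⟨∑' k : ℤ, 2 ^ θ * decay θ k,
    tsum_nonneg fun k => mul_nonneg (by positivity) (decay_pos _ _).le, fun y => ?_⟩
  have hle : ∀ k : ℤ, decay θ (y - (Equiv.addLeft ⌊y⌋ k : ℤ)) ≤ 2 ^ θ * decay θ k := fun k => by
    refine decay_le_mul (by linarith) two_pos ?_
    -- Up to a shift by `⌊y⌋` one may take `y ∈ [0, 1)`, and then `1 + |k| ≤ 2 (1 + |y - k|)`.
    have h1 := abs_sub_abs_le_abs_sub (k : ℝ) (y - ⌊y⌋)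
    have h2 : |y - ⌊y⌋| ≤ 1 := by
      rw [abs_of_nonneg (by linarith [Int.floor_le y])]
      linarith [Int.lt_floor_add_one y]
    have h3 : y - (Equiv.addLeft ⌊y⌋ k : ℤ) = y - ⌊y⌋ - k := by
      simp only [Equiv.coe_addLeft, Int.cast_add]; ring
    rw [h3, abs_sub_comm]
    linarith [abs_nonneg ((k : ℝ) - (y - ⌊y⌋))]
  have hs' : Summable fun k : ℤ => decay θ (y - (Equiv.addLeft ⌊y⌋ k : ℤ)) :=
    Summable.of_nonneg_of_le (fun k => (decay_pos _ _).le) hle hs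
  refine ⟨(Equiv.addLeft ⌊y⌋).summable_iff.1 hs', ?_⟩
  rw [← (Equiv.addLeft ⌊y⌋).tsum_eq]
  exact hs'.tsum_le_tsum hle hs

/-- The larger of `|a|`, `|b|` is at least `|b - a| / 2`, so one factor can be traded for the weight
at `b - a`. Summed over shifts, this bounds a discrete convolution of weights by a weight. -/
theorem decay_mul_decay_le {θ : ℝ} (hθ : 0 ≤ θ) (a b : ℝ) :
    decay θ a * decay θ b ≤ 2 ^ θ * decay θ (b - a) * (decay θ a + decay θ b) := by
  have ha := decay_pos θ a
  have hb := decay_pos θ b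
  have hc : 0 < 2 ^ θ * decay θ (b - a) := mul_pos (by positivity) (decay_pos _ _)
  have h := abs_sub b a
  rcases le_total |a| |b| with hab | hab
  · have := decay_le_mul hθ (a := b) (b := b - a) two_pos (by linarith)
    nlinarith
  · have := decay_le_mul hθ (a := a) (b := b - a) two_pos (by linarith)
    nlinarith

theorem DecaysWithOrder.exists_le_decay {ξ : ℝ → ℝ} {θ θ' C : ℝ} (h : DecaysWithOrder ξ θ)
    (hC : ∀ u, |ξ u| ≤ C) (h0 : 0 ≤ θ') (hθ : θ' ≤ θ) :
    ∃ A : ℝ, ∀ u, |ξ u| ≤ A * decay θ' u := by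
  obtain ⟨c, hc, hb⟩ := h.exists_pos
  rw [Asymptotics.IsBigOWith, ← Metric.cobounded_eq_cocompact,
    hasBasis_cobounded_norm.eventually_iff] at hb
  obtain ⟨R, -, hR⟩ := hb
  have hC0 : 0 ≤ C := (abs_nonneg _).trans (hC 0)
  refine ⟨c * 2 ^ θ' + C * (2 + |R|) ^ θ', fun u => ?_⟩
  have hd := decay_pos θ' u
  have hk1 : 0 ≤ c * 2 ^ θ' := by positivity
  have hk2 : 0 ≤ C * (2 + |R|) ^ θ' := by positivity
  -- For large `|u|` the asymptotic bound applies, elsewhere the weight is bounded below.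
  rcases le_total (max 1 |R|) |u| with hu | hu
  · have hu1 : 1 ≤ |u| := (le_max_left _ _).trans hu
    have h1 := hR (x := u) (((le_abs_self R).trans (le_max_right _ _)).trans hu)
    rw [Real.norm_eq_abs, Real.norm_of_nonneg (by positivity)] at h1
    have h2 : |u| ^ (-θ) ≤ |u| ^ (-θ') := Real.rpow_le_rpow_of_exponent_le hu1 (by linarith)
    have h3 : |u| ^ (-θ') ≤ 2 ^ θ' * decay θ' u := by
      calc |u| ^ (-θ') ≤ ((1 + |u|) / 2) ^ (-θ') :=
            Real.rpow_le_rpow_of_nonpos (by positivity) (by linarith) (by linarith)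
        _ = _ := by
          rw [Real.div_rpow (by positivity) (by norm_num), Real.rpow_neg (by norm_num : (0:ℝ) ≤ 2),
            div_inv_eq_mul, mul_comm, decay]
    calc |ξ u| ≤ c * (2 ^ θ' * decay θ' u) := h1.trans (by gcongr; exact h2.trans h3)
      _ ≤ _ := by nlinarith
  · have h1 : decay θ' 0 ≤ (2 + |R|) ^ θ' * decay θ' u :=
      decay_le_mul h0 (by positivity) (by
        have : max 1 |R| ≤ 1 + |R| := max_le (by linarith [abs_nonneg R]) (by linarith)
        simp only [abs_zero]
        linarith)
    have h2 : decay θ' 0 = 1 := by simp [decay]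
    rw [h2] at h1
    calc |ξ u| ≤ C * 1 := by simpa using hC u
      _ ≤ C * ((2 + |R|) ^ θ' * decay θ' u) := by gcongr
      _ ≤ _ := by nlinarith

end Decay

/-! ### The operator with `w = 1`: kernel bound and moments -/

section Operator

variable {φ ψ : ℝ → ℝ} {A θ : ℝ}

/-- The kernel `∑_k φ(x - k) ψ(u - k)` of `D_1` is dominated by an integrable function of `u - x`. -/
theorem exists_tsum_kernel_le (hθ : 1 < θ) (hφ : ∀ u, |φ u| ≤ A * decay θ u)
    (hψ : ∀ u, |ψ u| ≤ A * decay θ u) :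
    ∃ B : ℝ, 0 ≤ B ∧ ∀ x u, ∑' k : ℤ, ‖φ (x - k)‖ₑ * ‖ψ (u - k)‖ₑ
      ≤ ENNReal.ofReal (B * decay θ (u - x)) := by
  obtain ⟨S, hS0, hS⟩ := exists_tsum_decay_le hθ
  have hA : 0 ≤ A := nonneg_of_mul_nonneg_left ((abs_nonneg _).trans (hφ 0)) (decay_pos θ 0)
  refine ⟨A * A * 2 ^ θ * (2 * S), by positivity, fun x u => ?_⟩
  have hd := decay_pos θ (u - x)
  have hle : ∀ k : ℤ, ‖φ (x - k)‖ₑ * ‖ψ (u - k)‖ₑ ≤ ENNReal.ofReal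
      (A * A * (2 ^ θ * decay θ (u - x)) * (decay θ (x - k) + decay θ (u - k))) := fun k => by
    rw [Real.enorm_eq_ofReal_abs, Real.enorm_eq_ofReal_abs, ← ENNReal.ofReal_mul (abs_nonneg _)]
    refine ENNReal.ofReal_le_ofReal ?_
    have h1 := decay_mul_decay_le (θ := θ) (by linarith) (x - k) (u - k)
    rw [sub_sub_sub_cancel_right] at h1
    calc |φ (x - k)| * |ψ (u - k)| ≤ (A * decay θ (x - k)) * (A * decay θ (u - k)) :=
          mul_le_mul (hφ _) (hψ _) (abs_nonneg _) ((abs_nonneg _).trans (hφ _))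
      _ = A * A * (decay θ (x - k) * decay θ (u - k)) := by ring
      _ ≤ A * A * (2 ^ θ * decay θ (u - x) * (decay θ (x - k) + decay θ (u - k))) := by gcongr
      _ = _ := by ring
  have hs : Summable fun k : ℤ => decay θ (x - k) + decay θ (u - k) := (hS x).1.add (hS u).1
  refine (ENNReal.tsum_le_tsum hle).trans ?_
  rw [← ENNReal.ofReal_tsum_of_nonneg (fun k => ?_) (hs.mul_left _)]
  · refine ENNReal.ofReal_le_ofReal ?_
    rw [tsum_mul_left, (hS x).1.tsum_add (hS u).1]
    calc _ ≤ A * A * (2 ^ θ * decay θ (u - x)) * (S + S) := by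
          gcongr
          exacts [(hS x).2, (hS u).2]
      _ = _ := by ring
  · have := decay_pos θ (x - k)
    have := decay_pos θ (u - k)
    positivity

/-- The weighted integrability of `q` about `x` which, for kernels of decay `θ`, makes the integrals
and the series in `D_1 q(x)` converge absolutely. -/
def Admissible (θ x : ℝ) (q : ℝ → ℝ) : Prop := Integrable fun u => decay θ (u - x) * q u

theorem Admissible.sub {x : ℝ} {q q' : ℝ → ℝ} (h : Admissible θ x q) (h' : Admissible θ x q') :
    Admissible θ x (fun u => q u - q' u) := by
  exact (Integrable.sub h h').congr (.of_forall fun u => (mul_sub _ _ _).symm)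

theorem Admissible.sum_mul {x : ℝ} {ι : Type*} {s : Finset ι} {q : ι → ℝ → ℝ} (c : ι → ℝ)
    (h : ∀ i ∈ s, Admissible θ x (q i)) : Admissible θ x fun u => ∑ i ∈ s, c i * q i u := by
  have := integrable_finsetSum s fun i hi => (h i hi).const_mul (c i)
  refine this.congr (.of_forall fun u => ?_)
  simp only [Finset.mul_sum]
  exact Finset.sum_congr rfl fun i _ => by ring

theorem Admissible.aestronglyMeasurable {x : ℝ} {q : ℝ → ℝ} (h : Admissible θ x q) :
    AEStronglyMeasurable q volume := by
  have hc : Continuous fun u => (decay θ (u - x))⁻¹ :=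
    ((continuous_decay θ).comp (continuous_sub_right x)).inv₀ fun u => (decay_pos _ _).ne'
  refine (hc.aestronglyMeasurable.mul h.1).congr (.of_forall fun u => ?_)
  exact inv_mul_cancel_left₀ (decay_pos _ _).ne' _

/-- The weight is bounded and integrable, so `|f| ≤ 1 + |f|^p` replaces Hölder's inequality. -/
theorem admissible_of_memLp {p : ℝ≥0∞} (hp : 1 ≤ p) (hp' : p ≠ ⊤) (hθ : 1 < θ) {f : ℝ → ℝ}
    (hf : MemLp f p volume) (x : ℝ) : Admissible θ x f := by
  have hd : Integrable fun u => decay θ (u - x) := (integrable_decay hθ).comp_sub_right x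
  have hp1 : 1 ≤ p.toReal := by simpa using ENNReal.toReal_mono hp' hp
  have hfp : Integrable fun u => ‖f u‖ ^ p.toReal :=
    hf.integrable_norm_rpow (zero_lt_one.trans_le hp).ne' hp'
  refine (hd.add hfp).mono' (hd.1.mul hf.1) (.of_forall fun u => ?_)
  have h0 := decay_pos θ (u - x)
  have h1 := decay_le_one (θ := θ) (by linarith) (u - x)
  rw [norm_mul, Real.norm_of_nonneg h0.le]
  simp only [Pi.add_apply]
  rcases le_total ‖f u‖ 1 with h | h
  · have : 0 ≤ ‖f u‖ ^ p.toReal := by positivity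
    nlinarith
  · have : ‖f u‖ ≤ ‖f u‖ ^ p.toReal := Real.self_le_rpow_of_one_le h hp1
    nlinarith [norm_nonneg (f u)]

theorem admissible_pow {n : ℕ} (hθ : n + 1 < θ) (x : ℝ) : Admissible θ x fun u => (u - x) ^ n := by
  have hd : Integrable fun u => decay (θ - n) (u - x) :=
    (integrable_decay (by linarith)).comp_sub_right x
  have hc : Continuous fun u => decay θ (u - x) * (u - x) ^ n :=
    ((continuous_decay θ).comp (continuous_sub_right x)).mul (by fun_prop)
  refine hd.mono' hc.aestronglyMeasurable (.of_forall fun u => ?_)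
  rw [norm_mul, norm_pow, Real.norm_of_nonneg (decay_pos _ _).le, mul_comm]
  exact abs_pow_mul_decay_le θ (u - x) n

theorem Admissible.integrable_kernel_mul (hθ : 0 ≤ θ) (hψm : AEStronglyMeasurable ψ volume)
    (hψ : ∀ u, |ψ u| ≤ A * decay θ u) {x : ℝ} {q : ℝ → ℝ} (h : Admissible θ x q) (k : ℤ) :
    Integrable fun u => ψ (u - k) * q u := by
  have hA : 0 ≤ A := nonneg_of_mul_nonneg_left ((abs_nonneg _).trans (hψ 0)) (decay_pos θ 0)
  have hm : AEStronglyMeasurable (fun u => ψ (u - k)) volume :=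
    hψm.comp_measurePreserving (measurePreserving_sub_right volume (k : ℝ))
  refine (h.norm.const_mul (A * (1 + |x - k|) ^ θ)).mono' (hm.mul h.aestronglyMeasurable)
    (.of_forall fun u => ?_)
  have h1 : decay θ (u - k) ≤ (1 + |x - k|) ^ θ * decay θ (u - x) := by
    refine decay_le_mul hθ (by positivity) ?_
    have : |u - x| ≤ |u - k| + |x - k| := by
      have := abs_sub (u - k) (x - k)
      rwa [sub_sub_sub_cancel_right] at this
    nlinarith [mul_nonneg (abs_nonneg (x - k)) (abs_nonneg (u - k))]
  rw [norm_mul, norm_mul, Real.norm_of_nonneg (decay_pos θ (u - x)).le, Real.norm_eq_abs]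
  calc |ψ (u - k)| * ‖q u‖ ≤ (A * ((1 + |x - k|) ^ θ * decay θ (u - x))) * ‖q u‖ := by
        gcongr
        exact (hψ _).trans (by gcongr)
    _ = _ := by ring

theorem tsum_enorm_coeff_le {B : ℝ} (hψm : AEStronglyMeasurable ψ volume)
    (hB : ∀ x u, ∑' k : ℤ, ‖φ (x - k)‖ₑ * ‖ψ (u - k)‖ₑ ≤ ENNReal.ofReal (B * decay θ (u - x)))
    {x : ℝ} {q : ℝ → ℝ} (hq : AEStronglyMeasurable q volume) :
    ∑' k : ℤ, ‖φ (1 * x - k) * coeff ψ 1 q k‖ₑ ≤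
      ∫⁻ u, ENNReal.ofReal (B * decay θ (u - x)) * ‖q u‖ₑ := by
  have hm : ∀ k : ℤ, AEMeasurable (fun u => ‖φ (x - k)‖ₑ * ‖ψ (u - k)‖ₑ * ‖q u‖ₑ) volume := fun k =>
    ((hψm.comp_measurePreserving (measurePreserving_sub_right volume (k : ℝ))).enorm.const_mul
      _).mul hq.enorm
  calc _ ≤ ∑' k : ℤ, ∫⁻ u, ‖φ (x - k)‖ₑ * ‖ψ (u - k)‖ₑ * ‖q u‖ₑ := by
        refine ENNReal.tsum_le_tsum fun k => ?_
        simp only [coeff, one_mul, enorm_mul, mul_assoc]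
        rw [lintegral_const_mul' _ _ enorm_ne_top]
        gcongr
        refine (enorm_integral_le_lintegral_enorm _).trans (le_of_eq ?_)
        simp only [enorm_mul]
    _ = ∫⁻ u, (∑' k : ℤ, ‖φ (x - k)‖ₑ * ‖ψ (u - k)‖ₑ) * ‖q u‖ₑ := by
        rw [← lintegral_tsum hm]
        simp only [ENNReal.tsum_mul_right]
    _ ≤ _ := by gcongr with u; exact hB x u

theorem Admissible.lintegral_ne_top {B x : ℝ} (hB0 : 0 ≤ B) {q : ℝ → ℝ} (h : Admissible θ x q) :
    ∫⁻ u, ENNReal.ofReal (B * decay θ (u - x)) * ‖q u‖ₑ ≠ ⊤ := by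
  have h1 := (Integrable.const_mul h B).2
  refine (lt_of_le_of_lt (le_of_eq ?_) h1).ne
  refine lintegral_congr fun u => ?_
  beta_reduce
  rw [← mul_assoc, enorm_mul, Real.enorm_eq_ofReal (mul_nonneg hB0 (decay_pos _ _).le)]

theorem Admissible.summable {B x : ℝ} (hB0 : 0 ≤ B) (hψm : AEStronglyMeasurable ψ volume)
    (hB : ∀ x u, ∑' k : ℤ, ‖φ (x - k)‖ₑ * ‖ψ (u - k)‖ₑ ≤ ENNReal.ofReal (B * decay θ (u - x)))
    {q : ℝ → ℝ} (h : Admissible θ x q) :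
    Summable fun k : ℤ => φ (1 * x - k) * coeff ψ 1 q k :=
  .of_enorm (ne_top_of_le_ne_top (h.lintegral_ne_top hB0)
    (tsum_enorm_coeff_le hψm hB h.aestronglyMeasurable))

theorem enorm_durrmeyer_le {B x : ℝ} (hψm : AEStronglyMeasurable ψ volume)
    (hB : ∀ x u, ∑' k : ℤ, ‖φ (x - k)‖ₑ * ‖ψ (u - k)‖ₑ ≤ ENNReal.ofReal (B * decay θ (u - x)))
    {q : ℝ → ℝ} (hq : AEStronglyMeasurable q volume) :
    ‖durrmeyer φ ψ 1 q x‖ₑ ≤ ∫⁻ u, ENNReal.ofReal (B * decay θ (u - x)) * ‖q u‖ₑ :=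
  enorm_tsum_le_tsum_enorm.trans (tsum_enorm_coeff_le hψm hB hq)

/-- The moments of the kernel: `D_1` maps `(· - x)^n` to a function with value
`∑_ν (n choose ν) m_{n - ν}(φ, x) m̃_ν(ψ)` at `x`. -/
theorem durrmeyer_pow (hψm : AEStronglyMeasurable ψ volume) {n : ℕ} (hθ : n + 1 < θ)
    (hφ : ∀ u, |φ u| ≤ A * decay θ u) (hψ : ∀ u, |ψ u| ≤ A * decay θ u) (x : ℝ) :
    durrmeyer φ ψ 1 (fun u => (u - x) ^ n) x =
      ∑ ν ∈ Finset.range (n + 1),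
        (n.choose ν : ℝ) * discreteMoment φ (n - ν) x * continuousMoment ψ ν := by
  have hA : 0 ≤ A := nonneg_of_mul_nonneg_left ((abs_nonneg _).trans (hφ 0)) (decay_pos θ 0)
  have hint : ∀ ν ≤ n, Integrable fun u => u ^ ν * ψ u := fun ν hν => by
    have hν' : (ν : ℝ) ≤ n := by exact_mod_cast hν
    have := (admissible_pow (θ := θ) (n := ν) (by linarith) 0).integrable_kernel_mul
      (by linarith [(n.cast_nonneg : (0 : ℝ) ≤ n)]) hψm hψ 0
    simpa [mul_comm] using this
  have hsum : ∀ ν ≤ n, Summable fun k : ℤ => φ (x - k) * ((k : ℝ) - x) ^ ν := fun ν hν => by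
    have hν' : (ν : ℝ) ≤ n := by exact_mod_cast hν
    obtain ⟨S, -, hS⟩ := exists_tsum_decay_le (θ := θ - ν) (by linarith)
    refine ((hS x).1.mul_left A).of_norm_bounded fun k => ?_
    rw [norm_mul, norm_pow, Real.norm_eq_abs, Real.norm_eq_abs, abs_sub_comm (k : ℝ)]
    calc |φ (x - k)| * |x - k| ^ ν ≤ A * decay θ (x - k) * |x - k| ^ ν := by gcongr; exact hφ _
      _ = A * (|x - k| ^ ν * decay θ (x - k)) := by ring
      _ ≤ _ := by gcongr; exact abs_pow_mul_decay_le θ (x - k) ν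
  have hcoeff : ∀ k : ℤ, coeff ψ 1 (fun u => (u - x) ^ n) k =
      ∑ ν ∈ Finset.range (n + 1),
        ((k : ℝ) - x) ^ (n - ν) * (n.choose ν : ℝ) * continuousMoment ψ ν := fun k => by
    have h1 : ∀ u : ℝ, ψ (u - k) * (u - x) ^ n =
        (fun y => ∑ ν ∈ Finset.range (n + 1),
          ((k : ℝ) - x) ^ (n - ν) * (n.choose ν : ℝ) * (y ^ ν * ψ y)) (u - k) := fun u => by
      have : u - x = (u - k) + (k - x) := by ring
      rw [this, add_pow, Finset.mul_sum]
      exact Finset.sum_congr rfl fun ν _ => by ring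
    simp only [coeff, one_mul, h1]
    rw [integral_sub_right_eq_self
      (fun y => ∑ ν ∈ Finset.range (n + 1),
          ((k : ℝ) - x) ^ (n - ν) * (n.choose ν : ℝ) * (y ^ ν * ψ y)) (k : ℝ),
      integral_finsetSum _ fun ν hν => (hint ν (by simpa [Nat.lt_succ_iff] using hν)).const_mul _]
    simp only [integral_const_mul, continuousMoment]
  simp only [durrmeyer, hcoeff, Finset.mul_sum, one_mul]
  rw [Summable.tsum_finsetSum fun ν hν => ?_]
  · refine Finset.sum_congr rfl fun ν _ => ?_
    rw [discreteMoment, ← tsum_mul_left, ← tsum_mul_right]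
    exact tsum_congr fun k => by ring
  · refine (((hsum (n - ν) (Nat.sub_le _ _)).mul_left (n.choose ν : ℝ)).mul_right
      (continuousMoment ψ ν)).congr fun k => ?_
    ring

theorem durrmeyer_sub {B x : ℝ} (hθ : 0 ≤ θ) (hB0 : 0 ≤ B) (hψm : AEStronglyMeasurable ψ volume)
    (hψ : ∀ u, |ψ u| ≤ A * decay θ u)
    (hB : ∀ x u, ∑' k : ℤ, ‖φ (x - k)‖ₑ * ‖ψ (u - k)‖ₑ ≤ ENNReal.ofReal (B * decay θ (u - x)))
    {q q' : ℝ → ℝ} (h : Admissible θ x q) (h' : Admissible θ x q') :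
    durrmeyer φ ψ 1 (fun u => q u - q' u) x = durrmeyer φ ψ 1 q x - durrmeyer φ ψ 1 q' x := by
  rw [durrmeyer, durrmeyer, durrmeyer,
    ← (h.summable hB0 hψm hB).tsum_sub (h'.summable hB0 hψm hB)]
  refine tsum_congr fun k => ?_
  simp only [coeff, one_mul, mul_sub]
  rw [integral_sub (h.integrable_kernel_mul hθ hψm hψ k) (h'.integrable_kernel_mul hθ hψm hψ k)]
  ring

theorem durrmeyer_sum_mul {B x : ℝ} (hθ : 0 ≤ θ) (hB0 : 0 ≤ B)
    (hψm : AEStronglyMeasurable ψ volume) (hψ : ∀ u, |ψ u| ≤ A * decay θ u)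
    (hB : ∀ x u, ∑' k : ℤ, ‖φ (x - k)‖ₑ * ‖ψ (u - k)‖ₑ ≤ ENNReal.ofReal (B * decay θ (u - x)))
    {ι : Type*} {s : Finset ι} {q : ι → ℝ → ℝ} (c : ι → ℝ)
    (h : ∀ i ∈ s, Admissible θ x (q i)) :
    durrmeyer φ ψ 1 (fun u => ∑ i ∈ s, c i * q i u) x
      = ∑ i ∈ s, c i * durrmeyer φ ψ 1 (q i) x := by
  simp only [durrmeyer, ← tsum_mul_left]
  rw [← Summable.tsum_finsetSum fun i hi => ((h i hi).summable hB0 hψm hB).mul_left (c i)]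
  refine tsum_congr fun k => ?_
  have : ∀ u, ψ (u - k) * ∑ i ∈ s, c i * q i u = ∑ i ∈ s, c i * (ψ (u - k) * q i u) := fun u => by
    rw [Finset.mul_sum]; exact Finset.sum_congr rfl fun i _ => by ring
  simp only [coeff, one_mul, this]
  rw [integral_finsetSum _ fun i hi =>
    ((h i hi).integrable_kernel_mul hθ hψm hψ k).const_mul (c i), Finset.mul_sum]
  exact Finset.sum_congr rfl fun i _ => by rw [integral_const_mul]; ring

end Operator

/-! ### The error estimate for `w = 1` -/

section Estimate

variable {p : ℝ≥0∞}

/-- Minkowski's integral inequality for a density `W`. -/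
theorem eLpNorm_lintegral_weight_le (hp : 1 ≤ p) (hp' : p ≠ ⊤) {W : ℝ → ℝ≥0∞}
    (hW : Measurable W) {F : ℝ → ℝ → ℝ≥0∞} (hF : Measurable (Function.uncurry F)) {M : ℝ≥0∞}
    (hM : ∀ v, eLpNorm (fun x => F x v) p volume ≤ M) :
    eLpNorm (fun x => ∫⁻ v, W v * F x v) p volume ≤ (∫⁻ v, W v) * M := by
  have h := eLpNorm_lintegral_le (μ := (volume : Measure ℝ)) (κ := volume.withDensity W)
    hp hp' hF (.of_forall hM)
  rw [withDensity_apply _ MeasurableSet.univ, Measure.restrict_univ] at h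
  refine (le_of_eq ?_).trans h
  congr 1
  ext x
  exact (lintegral_withDensity_eq_lintegral_mul _ hW
    (hF.comp (measurable_prodMk_left (x := x)))).symm

variable {φ ψ : ℝ → ℝ} {A B θ : ℝ}

theorem lintegral_weight_ne_top (hθ : 1 < θ) (B : ℝ) :
    ∫⁻ v, ENNReal.ofReal (B * decay θ v) ≠ ⊤ := by
  refine (lt_of_le_of_lt ?_ ((integrable_decay hθ).const_mul B).2).ne
  exact lintegral_mono fun v => Real.ofReal_le_enorm _

theorem lintegral_weight_mul_pow_ne_top {r : ℕ} (hθ : r + 1 < θ) (hB0 : 0 ≤ B) :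
    ∫⁻ v, ENNReal.ofReal (B * decay θ v) * ENNReal.ofReal (|v| ^ r) ≠ ⊤ := by
  refine ne_top_of_le_ne_top (lintegral_weight_ne_top (θ := θ - r) (by linarith) B)
    (lintegral_mono fun v => ?_)
  have := decay_pos θ v
  rw [← ENNReal.ofReal_mul (by positivity)]
  refine ENNReal.ofReal_le_ofReal ?_
  calc B * decay θ v * |v| ^ r = B * (|v| ^ r * decay θ v) := by ring
    _ ≤ _ := by gcongr; exact abs_pow_mul_decay_le θ v r

theorem measurable_weight (θ B : ℝ) : Measurable fun v => ENNReal.ofReal (B * decay θ v) :=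
  ((continuous_decay θ).measurable.const_mul B).ennreal_ofReal

theorem lintegral_weight_sub (G : ℝ → ℝ≥0∞) (x : ℝ) :
    ∫⁻ u, ENNReal.ofReal (B * decay θ (u - x)) * G u
      = ∫⁻ v, ENNReal.ofReal (B * decay θ v) * G (x + v) := by
  rw [← lintegral_add_left_eq_self _ x]
  simp only [add_sub_cancel_left]

theorem durrmeyer_congr_ae {f g : ℝ → ℝ} (h : f =ᵐ[volume] g) (w : ℝ) :
    durrmeyer φ ψ w f = durrmeyer φ ψ w g := by
  have hc : ∀ k, coeff ψ w f k = coeff ψ w g k := fun k => by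
    unfold coeff
    congr 1
    exact integral_congr_ae (h.mono fun u hu => by simp only [hu])
  ext x
  simp only [durrmeyer, hc]

theorem eLpNorm_durrmeyer_one_le (hp : 1 ≤ p) (hp' : p ≠ ⊤)
    (hψm : AEStronglyMeasurable ψ volume)
    (hB : ∀ x u, ∑' k : ℤ, ‖φ (x - k)‖ₑ * ‖ψ (u - k)‖ₑ ≤ ENNReal.ofReal (B * decay θ (u - x)))
    {f : ℝ → ℝ} (hf : MemLp f p volume) :
    eLpNorm (durrmeyer φ ψ 1 f) p volume
      ≤ (∫⁻ v, ENNReal.ofReal (B * decay θ v)) * eLpNorm f p volume := by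
  obtain ⟨g, hg, hfg⟩ := hf.1
  rw [durrmeyer_congr_ae hfg, eLpNorm_congr_ae hfg]
  have hgm := hg.measurable
  refine le_trans ?_ (eLpNorm_lintegral_weight_le hp hp' (measurable_weight θ B)
    (F := fun x v => ‖g (x + v)‖ₑ) (hgm.comp (by fun_prop : Measurable
      fun z : ℝ × ℝ => z.1 + z.2)).enorm (M := eLpNorm g p volume) fun v => ?_)
  · refine eLpNorm_mono_enorm fun x => ?_
    rw [enorm_eq_self, ← lintegral_weight_sub (fun u => ‖g u‖ₑ)]
    exact enorm_durrmeyer_le hψm hB hgm.aestronglyMeasurable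
  · rw [eLpNorm_enorm, eLpNorm_comp_add_right hgm.aestronglyMeasurable]

theorem aestronglyMeasurable_durrmeyer_one (hφm : AEStronglyMeasurable φ volume) (f : ℝ → ℝ) :
    AEStronglyMeasurable (durrmeyer φ ψ 1 f) volume := by
  refine AEMeasurable.aestronglyMeasurable (AEMeasurable.tsum fun k => ?_)
  simp only [one_mul]
  exact ((hφm.comp_measurePreserving
    (measurePreserving_sub_right volume (k : ℝ))).aemeasurable).mul_const _

/-- The pointwise form of the estimate. As `D_1` reproduces the Taylor polynomial of a smooth `G 0`
at `x` up to degree `r - 1`, the error is that of `f - G 0` plus that of the Taylor remainder. -/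
theorem enorm_durrmeyer_sub_le {r : ℕ} (hr : 1 ≤ r) (hθ : r + 1 < θ) (hB0 : 0 ≤ B)
    (hψm : AEStronglyMeasurable ψ volume) (hψ : ∀ u, |ψ u| ≤ A * decay θ u)
    (hB : ∀ x u, ∑' k : ℤ, ‖φ (x - k)‖ₑ * ‖ψ (u - k)‖ₑ ≤ ENNReal.ofReal (B * decay θ (u - x)))
    {x : ℝ} (hmom : ∀ n < r, durrmeyer φ ψ 1 (fun u => (u - x) ^ n) x = if n = 0 then 1 else 0)
    {f : ℝ → ℝ} (hf : Admissible θ x f) {G : ℕ → ℝ → ℝ} (hGm : Measurable (G 0))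
    (hG : ∀ i < r, ∀ x, HasDerivAt (G i) (G (i + 1) x) x) (hc : Continuous (G r)) :
    ‖durrmeyer φ ψ 1 f x - f x‖ₑ ≤
      (∫⁻ v, ENNReal.ofReal (B * decay θ v) * ‖f (x + v) - G 0 (x + v)‖ₑ) +
      (∫⁻ v, (ENNReal.ofReal (B * decay θ v) * ENNReal.ofReal (|v| ^ r)) *
        ∫⁻ s in Set.Ioc 0 1, ‖G r (x + v * s)‖ₑ) + ‖f x - G 0 x‖ₑ := by
  have hθ0 : 0 ≤ θ := by linarith [(r.cast_nonneg : (0 : ℝ) ≤ r)]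
  set c : ℕ → ℝ := fun i => G i x / i.factorial with hcdef
  have hpow : ∀ i ∈ Finset.range r, Admissible θ x fun u => (u - x) ^ i := fun i hi =>
    admissible_pow (by
      have : (i : ℝ) + 1 ≤ r := by exact_mod_cast Finset.mem_range.1 hi
      linarith) x
  have hP : Admissible θ x fun u => ∑ i ∈ Finset.range r, c i * (u - x) ^ i :=
    Admissible.sum_mul c hpow
  have hTP : durrmeyer φ ψ 1 (fun u => ∑ i ∈ Finset.range r, c i * (u - x) ^ i) x = G 0 x := by
    rw [durrmeyer_sum_mul hθ0 hB0 hψm hψ hB c hpow,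
      Finset.sum_congr rfl fun i hi => by rw [hmom i (Finset.mem_range.1 hi)]]
    simp [hcdef, show 0 < r from hr]
  have hsplit : durrmeyer φ ψ 1 f x - f x =
      durrmeyer φ ψ 1 (fun u => f u - ∑ i ∈ Finset.range r, c i * (u - x) ^ i) x
        - (f x - G 0 x) := by
    rw [durrmeyer_sub hθ0 hB0 hψm hψ hB hf hP, hTP]
    ring
  have hmeas : AEMeasurable (fun v => ENNReal.ofReal (B * decay θ v) *
      ‖f (x + v) - G 0 (x + v)‖ₑ) volume := by
    have h1 : AEStronglyMeasurable (fun v => f (x + v)) volume :=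
      hf.aestronglyMeasurable.comp_measurePreserving (measurePreserving_add_left volume x)
    exact (measurable_weight θ B).aemeasurable.mul
      (h1.sub (hGm.comp (measurable_const_add x)).aestronglyMeasurable).enorm
  rw [hsplit]
  refine enorm_sub_le.trans (add_le_add_left ?_ _)
  refine (enorm_durrmeyer_le hψm hB (hf.sub hP).aestronglyMeasurable).trans ?_
  rw [lintegral_weight_sub (fun u => ‖f u - ∑ i ∈ Finset.range r, c i * (u - x) ^ i‖ₑ),
    ← lintegral_add_left' hmeas]
  refine lintegral_mono fun v => ?_
  rw [mul_assoc, ← mul_add]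
  gcongr
  have hrem := enorm_taylor_remainder_le hr hG hc x v
  have e : f (x + v) - ∑ i ∈ Finset.range r, c i * (x + v - x) ^ i
      = (f (x + v) - G 0 (x + v)) +
        (G 0 (x + v) - ∑ i ∈ Finset.range r, G i x * (v ^ i / i.factorial)) := by
    have : ∑ i ∈ Finset.range r, c i * (x + v - x) ^ i
        = ∑ i ∈ Finset.range r, G i x * (v ^ i / i.factorial) :=
      Finset.sum_congr rfl fun i _ => by rw [add_sub_cancel_left]; simp only [hcdef]; ring
    rw [this]; ring
  rw [e]
  exact (enorm_add_le _ _).trans (by gcongr)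

theorem exists_eLpNorm_durrmeyer_one_sub_le (hp : 1 ≤ p) (hp' : p ≠ ⊤) {r : ℕ} (hr : 1 ≤ r)
    (hθ : r + 1 < θ) (hB0 : 0 ≤ B)
    (hψm : AEStronglyMeasurable ψ volume) (hψ : ∀ u, |ψ u| ≤ A * decay θ u)
    (hB : ∀ x u, ∑' k : ℤ, ‖φ (x - k)‖ₑ * ‖ψ (u - k)‖ₑ ≤ ENNReal.ofReal (B * decay θ (u - x)))
    (hmom : ∀ x, ∀ n < r,
      durrmeyer φ ψ 1 (fun u => (u - x) ^ n) x = if n = 0 then 1 else 0) :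
    ∃ K : ℝ≥0∞, K ≠ ⊤ ∧ ∀ f : ℝ → ℝ, MemLp f p volume →
      eLpNorm (fun x => durrmeyer φ ψ 1 f x - f x) p volume ≤ K * modulus r p f 1 := by
  -- With this step the nested averages in the smoothing only see `Δ_τ^r f` with `|τ| ≤ 1`.
  set h : ℝ := 1 / (r + 1 : ℕ) with hh
  have hh0 : 0 < h := by positivity
  have hrh1 : (r + 1 : ℕ) * h = 1 := mul_one_div_cancel (by positivity)
  have hrh : r * h ≤ 1 := by
    rw [← hrh1]
    gcongr
    simp
  set S : ℝ≥0∞ := ∑ j ∈ Finset.range r,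
    ‖(-1) ^ j * (r.choose (j + 1) : ℝ) * (((j + 1 : ℕ) * h)⁻¹) ^ r‖ₑ with hS
  set W : ℝ → ℝ≥0∞ := fun v => ENNReal.ofReal (B * decay θ v) with hW
  set W' : ℝ → ℝ≥0∞ := fun v => W v * ENNReal.ofReal (|v| ^ r) with hW'
  have hWm : Measurable W := measurable_weight θ B
  have hWm' : Measurable W' := hWm.mul (by fun_prop)
  refine ⟨(∫⁻ v, W v) + (∫⁻ v, W' v) * S + 1, ?_, fun f hf => ?_⟩
  · have hS' : S ≠ ⊤ := ENNReal.sum_ne_top.2 fun j _ => enorm_ne_top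
    exact ENNReal.add_ne_top.2 ⟨ENNReal.add_ne_top.2 ⟨lintegral_weight_ne_top (by linarith) B,
      ENNReal.mul_ne_top (lintegral_weight_mul_pow_ne_top hθ hB0) hS'⟩, ENNReal.one_ne_top⟩
  obtain ⟨f', hf'm, hff'⟩ := hf.1
  have hf' : MemLp f' p volume := (memLp_congr_ae hff').1 hf
  have hsub : (fun x => durrmeyer φ ψ 1 f x - f x) =ᵐ[volume]
      fun x => durrmeyer φ ψ 1 f' x - f' x := by
    rw [durrmeyer_congr_ae hff']
    exact hff'.mono fun x hx => by simp only [hx]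
  rw [eLpNorm_congr_ae hsub, modulus_congr_ae hff']
  have hm := hf'm.measurable
  have hint : ∀ a b, IntervalIntegrable f' volume a b := fun a b =>
    ((hf'.locallyIntegrable hp).integrableOn_isCompact isCompact_uIcc).intervalIntegrable
  set G := smoothing r h f' with hGdef
  have hGm : ∀ i, Measurable (G i) := measurable_smoothing hm r h
  set ω := modulus r p f' 1
  have hdiff : eLpNorm (f' - G 0) p volume ≤ ω :=
    eLpNorm_sub_smoothing_le hp hp' r hh0.le hm hint hrh1.le
  have hdiffm : Measurable (f' - G 0) := hm.sub (hGm 0)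
  have hGr : eLpNorm (G r) p volume ≤ S * ω := eLpNorm_smoothing_le hp hp' r hh0 hm hint hrh
  have hF1 : Measurable (Function.uncurry fun x v : ℝ => ‖(f' - G 0) (x + v)‖ₑ) :=
    (hdiffm.comp (by fun_prop : Measurable fun z : ℝ × ℝ => z.1 + z.2)).enorm
  have hF3 : Measurable fun z : (ℝ × ℝ) × ℝ => ‖G r (z.1.1 + z.1.2 * z.2)‖ₑ :=
    ((hGm r).comp (by fun_prop)).enorm
  have hF2 : Measurable (Function.uncurry fun x v : ℝ =>
      ∫⁻ s in Set.Ioc (0 : ℝ) 1, ‖G r (x + v * s)‖ₑ) :=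
    hF3.lintegral_prod_right' (ν := volume.restrict (Set.Ioc (0 : ℝ) 1))
  have hI1 : eLpNorm (fun x => ∫⁻ v, W v * ‖(f' - G 0) (x + v)‖ₑ) p volume
      ≤ (∫⁻ v, W v) * ω :=
    eLpNorm_lintegral_weight_le hp hp' hWm hF1 fun v => by
      rw [eLpNorm_enorm (f := fun x => (f' - G 0) (x + v)),
        eLpNorm_comp_add_right hdiffm.aestronglyMeasurable]
      exact hdiff
  have hI2 : eLpNorm (fun x => ∫⁻ v, W' v * ∫⁻ s in Set.Ioc (0 : ℝ) 1, ‖G r (x + v * s)‖ₑ) p volume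
      ≤ (∫⁻ v, W' v) * (S * ω) :=
    eLpNorm_lintegral_weight_le hp hp' hWm' hF2 fun v => by
      have := eLpNorm_lintegral_le (μ := (volume : Measure ℝ))
        (κ := volume.restrict (Set.Ioc (0 : ℝ) 1)) hp hp'
        (F := fun x s => ‖G r (x + v * s)‖ₑ) (A := S * ω)
        ((hGm r).comp (by fun_prop : Measurable fun z : ℝ × ℝ => z.1 + v * z.2)).enorm
        (.of_forall fun s => by
          rw [eLpNorm_enorm (f := fun x => G r (x + v * s)),
            eLpNorm_comp_add_right (hGm r).aestronglyMeasurable]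
          exact hGr)
      simpa using this
  have hm1 : Measurable fun x => ∫⁻ v, W v * ‖(f' - G 0) (x + v)‖ₑ :=
    ((hWm.comp measurable_snd).mul hF1).lintegral_prod_right'
  have hm2 : Measurable fun x => ∫⁻ v, W' v * ∫⁻ s in Set.Ioc (0 : ℝ) 1, ‖G r (x + v * s)‖ₑ :=
    ((hWm'.comp measurable_snd).mul hF2).lintegral_prod_right'
  have hm3 : Measurable fun x => ‖(f' - G 0) x‖ₑ := hdiffm.enorm
  calc eLpNorm (fun x => durrmeyer φ ψ 1 f' x - f' x) p volume
      ≤ eLpNorm ((fun x => ∫⁻ v, W v * ‖(f' - G 0) (x + v)‖ₑ) +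
          (fun x => ∫⁻ v, W' v * ∫⁻ s in Set.Ioc (0 : ℝ) 1, ‖G r (x + v * s)‖ₑ) +
          fun x => ‖(f' - G 0) x‖ₑ) p volume :=
        eLpNorm_mono_enorm fun x => by
          rw [enorm_eq_self]
          exact enorm_durrmeyer_sub_le hr hθ hB0 hψm hψ hB (hmom x)
            (admissible_of_memLp hp hp' (by linarith) hf' x) (hGm 0)
            (fun i hi => hasDerivAt_smoothing hint hh0 hi) (continuous_smoothing hint r hh0)
    _ ≤ (∫⁻ v, W v) * ω + (∫⁻ v, W' v) * (S * ω) + ω := by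
        refine (eLpNorm_add_le (hm1.add hm2).aestronglyMeasurable hm3.aestronglyMeasurable
          hp).trans (add_le_add ((eLpNorm_add_le hm1.aestronglyMeasurable
            hm2.aestronglyMeasurable hp).trans (add_le_add hI1 hI2)) ?_)
        rwa [eLpNorm_enorm (f := f' - G 0)]
    _ = _ := by ring

end Estimate

/-! ### Dilation to general `w` -/

section Scaling

variable {p : ℝ≥0∞} {φ ψ : ℝ → ℝ} {w : ℝ}

theorem coeff_eq_coeff_one (hw : 0 < w) (f : ℝ → ℝ) (k : ℤ) :
    coeff ψ w f k = coeff ψ 1 (fun y => f (w⁻¹ * y)) k := by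
  have h := Measure.integral_comp_mul_left (fun y => ψ (y - k) * f (w⁻¹ * y)) w
  simp only [inv_mul_cancel_left₀ hw.ne', abs_of_pos (inv_pos.2 hw), smul_eq_mul] at h
  simp only [coeff, one_mul]
  rw [h, mul_inv_cancel_left₀ hw.ne']

theorem durrmeyer_eq_durrmeyer_one (hw : 0 < w) (f : ℝ → ℝ) (x : ℝ) :
    durrmeyer φ ψ w f x = durrmeyer φ ψ 1 (fun y => f (w⁻¹ * y)) (w * x) := by
  simp only [durrmeyer, coeff_eq_coeff_one hw, one_mul]

theorem quasiMeasurePreserving_mul_left (hw : w ≠ 0) :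
    Measure.QuasiMeasurePreserving (fun x : ℝ => w * x) volume volume := by
  refine ⟨measurable_const_mul w, ?_⟩
  rw [Real.map_volume_mul_left hw]
  exact Measure.smul_absolutelyContinuous

theorem eLpNorm_comp_mul_left (hp' : p ≠ ⊤) (hw : w ≠ 0) {F : ℝ → ℝ}
    (hF : AEStronglyMeasurable F volume) :
    eLpNorm (fun x => F (w * x)) p volume
      = ENNReal.ofReal |w⁻¹| ^ (1 / p).toReal * eLpNorm F p volume := by
  have h := eLpNorm_map_measure (p := p) (f := fun x => w * x) (μ := (volume : Measure ℝ)) (g := F)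
    (by rw [Real.map_volume_mul_left hw]; exact hF.smul_measure _)
    (measurable_const_mul w).aemeasurable
  rw [Real.map_volume_mul_left hw, eLpNorm_smul_measure_of_ne_top hp', smul_eq_mul] at h
  exact h.symm

theorem memLp_comp_mul_left (hp' : p ≠ ⊤) (hw : w ≠ 0) {F : ℝ → ℝ} (hF : MemLp F p volume) :
    MemLp (fun x => F (w * x)) p volume := by
  refine ⟨hF.1.comp_quasiMeasurePreserving (quasiMeasurePreserving_mul_left hw), ?_⟩
  rw [eLpNorm_comp_mul_left hp' hw hF.1]
  exact ENNReal.mul_lt_top (ENNReal.rpow_lt_top_of_nonneg ENNReal.toReal_nonneg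
    ENNReal.ofReal_ne_top) hF.2

/-- The factor is the one by which the dilation changes the `L^p` norm. -/
theorem modulus_comp_mul_left_le (hp' : p ≠ ⊤) (hw : 0 < w) {f : ℝ → ℝ} (hf : Measurable f)
    (n : ℕ) (δ : ℝ) :
    modulus n p (fun x => f (w * x)) δ
      ≤ ENNReal.ofReal |w⁻¹| ^ (1 / p).toReal * modulus n p f (w * δ) := by
  refine iSup₂_le fun t ht => ?_
  have h : finiteDiff n t (fun x => f (w * x)) = fun x => finiteDiff n (w * t) f (w * x) := by
    ext x
    simp only [finiteDiff]
    refine Finset.sum_congr rfl fun j _ => ?_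
    congr 2
    ring
  rw [h, eLpNorm_comp_mul_left hp' hw.ne' (measurable_finiteDiff hf n _).aestronglyMeasurable]
  gcongr
  refine eLpNorm_finiteDiff_le_modulus n f ?_
  rw [abs_mul, abs_of_pos hw]
  gcongr

theorem eLpNorm_durrmeyer_sub_le (hp' : p ≠ ⊤) {r : ℕ} {K : ℝ≥0∞}
    (hφm : AEStronglyMeasurable φ volume)
    (hK : ∀ f : ℝ → ℝ, MemLp f p volume →
      eLpNorm (fun x => durrmeyer φ ψ 1 f x - f x) p volume ≤ K * modulus r p f 1)
    (hw : 0 < w) {f : ℝ → ℝ} (hf : MemLp f p volume) :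
    eLpNorm (fun x => durrmeyer φ ψ w f x - f x) p volume ≤ K * modulus r p f w⁻¹ := by
  obtain ⟨f', hf'm, hff'⟩ := hf.1
  have hf' : MemLp f' p volume := (memLp_congr_ae hff').1 hf
  have hsub : (fun x => durrmeyer φ ψ w f x - f x) =ᵐ[volume]
      fun x => durrmeyer φ ψ w f' x - f' x := by
    rw [durrmeyer_congr_ae hff']
    exact hff'.mono fun x hx => by simp only [hx]
  rw [eLpNorm_congr_ae hsub, modulus_congr_ae hff']
  have hw' : 0 < w⁻¹ := inv_pos.2 hw
  set g : ℝ → ℝ := fun y => f' (w⁻¹ * y) with hg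
  have hgp : MemLp g p volume := memLp_comp_mul_left hp' hw'.ne' hf'
  have he : (fun x => durrmeyer φ ψ w f' x - f' x) =
      fun x => (fun y => durrmeyer φ ψ 1 g y - g y) (w * x) := by
    ext x
    simp only [hg, durrmeyer_eq_durrmeyer_one hw, inv_mul_cancel_left₀ hw.ne']
  set q := (1 / p).toReal
  have hcancel : ENNReal.ofReal |w⁻¹| ^ q * ENNReal.ofReal |(w⁻¹)⁻¹| ^ q = 1 := by
    rw [← ENNReal.mul_rpow_of_nonneg _ _ ENNReal.toReal_nonneg,
      ← ENNReal.ofReal_mul (abs_nonneg _), ← abs_mul, mul_inv_cancel₀ hw'.ne']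
    simp
  rw [he, eLpNorm_comp_mul_left (F := fun y => durrmeyer φ ψ 1 g y - g y) hp' hw.ne'
    ((aestronglyMeasurable_durrmeyer_one hφm g).sub hgp.1)]
  calc ENNReal.ofReal |w⁻¹| ^ q * eLpNorm (fun y => durrmeyer φ ψ 1 g y - g y) p volume
      ≤ ENNReal.ofReal |w⁻¹| ^ q *
          (K * (ENNReal.ofReal |(w⁻¹)⁻¹| ^ q * modulus r p f' (w⁻¹ * 1))) := by
        gcongr
        refine (hK g hgp).trans ?_
        gcongr
        exact modulus_comp_mul_left_le hp' hw' hf'm.measurable r 1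
    _ = (ENNReal.ofReal |w⁻¹| ^ q * ENNReal.ofReal |(w⁻¹)⁻¹| ^ q) *
          (K * modulus r p f' (w⁻¹ * 1)) := by ring
    _ = K * modulus r p f' w⁻¹ := by rw [hcancel, one_mul, mul_one]

theorem ModulusBigO.hasRate (hp' : p ≠ ⊤) {r : ℕ} {K : ℝ≥0∞} (hKtop : K ≠ ⊤)
    (hφm : AEStronglyMeasurable φ volume)
    (hK : ∀ f : ℝ → ℝ, MemLp f p volume →
      eLpNorm (fun x => durrmeyer φ ψ 1 f x - f x) p volume ≤ K * modulus r p f 1)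
    {β : ℝ} {f : ℝ → ℝ} (hf : ModulusBigO r β p f) : HasRate φ ψ p β f := by
  obtain ⟨hfp, C, δ₀, hδ₀, h⟩ := hf
  refine ⟨K.toReal * C, δ₀⁻¹, inv_pos.2 hδ₀, fun w hw => ?_⟩
  have hw0 : 0 < w := (inv_pos.2 hδ₀).trans_le hw
  calc _ ≤ K * modulus r p f w⁻¹ := eLpNorm_durrmeyer_sub_le hp' hφm hK hw0 hfp
    _ ≤ K * ENNReal.ofReal (C * w⁻¹ ^ β) := by
        gcongr
        exact h _ (inv_pos.2 hw0) (inv_le_of_inv_le₀ hδ₀ hw)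
    _ = _ := by
        rw [mul_assoc, ENNReal.ofReal_mul ENNReal.toReal_nonneg, ENNReal.ofReal_toReal hKtop,
          Real.inv_rpow hw0.le, Real.rpow_neg hw0.le]

theorem wellDefinedOn_of_decay (hp : 1 ≤ p) (hp' : p ≠ ⊤) {A B θ : ℝ} (hθ : 1 < θ) (hB0 : 0 ≤ B)
    (hφm : AEStronglyMeasurable φ volume)
    (hψm : AEStronglyMeasurable ψ volume) (hψ : ∀ u, |ψ u| ≤ A * decay θ u)
    (hB : ∀ x u, ∑' k : ℤ, ‖φ (x - k)‖ₑ * ‖ψ (u - k)‖ₑ ≤ ENNReal.ofReal (B * decay θ (u - x)))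
    {f : ℝ → ℝ} (hf : MemLp f p volume) : WellDefinedOn φ ψ p f := by
  intro w hw
  have hg : MemLp (fun y => f (w⁻¹ * y)) p volume :=
    memLp_comp_mul_left hp' (inv_pos.2 hw).ne' hf
  have hadm := admissible_of_memLp hp hp' hθ hg
  refine ⟨fun k => ?_, fun x => ?_, ?_⟩
  · have := ((hadm 0).integrable_kernel_mul (by linarith) hψm hψ k).comp_mul_left' hw.ne'
    simpa only [inv_mul_cancel_left₀ hw.ne'] using this
  · simpa only [one_mul, coeff_eq_coeff_one hw] using (hadm (w * x)).summable hB0 hψm hB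
  · have he : durrmeyer φ ψ w f = fun x => durrmeyer φ ψ 1 (fun y => f (w⁻¹ * y)) (w * x) :=
      funext (durrmeyer_eq_durrmeyer_one hw f)
    rw [he]
    refine memLp_comp_mul_left hp' hw.ne' ⟨aestronglyMeasurable_durrmeyer_one hφm _, ?_⟩
    exact (eLpNorm_durrmeyer_one_le hp hp' hψm hB hg).trans_lt
      (ENNReal.mul_lt_top (lintegral_weight_ne_top hθ B).lt_top hg.2)

end Scaling

/-! ### From the decay conditions to the rates -/

section Conclusion

variable {p : ℝ≥0∞} {φ ψ : ℝ → ℝ}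

/-- As the supremum in `absMomentZero` is over all points, its finiteness bounds `ψ` everywhere. -/
theorem abs_le_of_absMomentZero_lt_top (h : absMomentZero ψ < ⊤) :
    ∃ C : ℝ, ∀ u, |ψ u| ≤ C := by
  refine ⟨(absMomentZero ψ).toReal, fun u => (ENNReal.ofReal_le_iff_le_toReal h.ne).1 ?_⟩
  have h1 : ENNReal.ofReal |ψ u| ≤ ∑' k : ℤ, ENNReal.ofReal |ψ (u - k)| := by
    simpa using ENNReal.le_tsum (f := fun k : ℤ => ENNReal.ofReal |ψ (u - k)|) 0
  exact h1.trans (le_iSup (fun u : ℝ => ∑' k : ℤ, ENNReal.ofReal |ψ (u - k)|) u)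

/-- The common core of the cases `1 < p` and `p = 1`. -/
theorem wellDefinedOn_and_hasRate (hp : 1 ≤ p) (hp' : p ≠ ⊤) {r : ℕ} (hr : 1 ≤ r)
    (hφ : IsDiscreteKernel φ) (hψ : IsContinuousKernel ψ) (hψM : absMomentZero ψ < ⊤)
    (hii : VanishingMoments φ ψ r) {θ₁ θ₂ : ℝ} (hθ₁ : r + 1 < θ₁) (hθ₂ : r + 1 < θ₂)
    (hφd : DecaysWithOrder φ θ₁) (hψd : DecaysWithOrder ψ θ₂) :
    (∀ f : ℝ → ℝ, MemLp f p volume → WellDefinedOn φ ψ p f) ∧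
      ∀ (β : ℝ) (f : ℝ → ℝ), ModulusBigO r β p f → HasRate φ ψ p β f := by
  obtain ⟨C₁, hC₁⟩ := hφ.bounded
  obtain ⟨C₂, hC₂⟩ := abs_le_of_absMomentZero_lt_top hψM
  set θ := min θ₁ θ₂ with hθdef
  have hθ : (r : ℝ) + 1 < θ := lt_min hθ₁ hθ₂
  have hr0 : (0 : ℝ) ≤ r := r.cast_nonneg
  obtain ⟨A₁, hA₁⟩ := hφd.exists_le_decay (θ' := θ) hC₁ (by linarith) (min_le_left _ _)
  obtain ⟨A₂, hA₂⟩ := hψd.exists_le_decay (θ' := θ) hC₂ (by linarith) (min_le_right _ _)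
  have hA₁' : ∀ u, |φ u| ≤ max A₁ A₂ * decay θ u := fun u => (hA₁ u).trans
    (mul_le_mul_of_nonneg_right (le_max_left _ _) (decay_pos θ u).le)
  have hA₂' : ∀ u, |ψ u| ≤ max A₁ A₂ * decay θ u := fun u => (hA₂ u).trans
    (mul_le_mul_of_nonneg_right (le_max_right _ _) (decay_pos θ u).le)
  have hφm := hφ.integrable.1
  have hψm := hψ.integrable.1
  obtain ⟨B, hB0, hB⟩ := exists_tsum_kernel_le (by linarith) hA₁' hA₂'
  have hmom : ∀ x, ∀ n < r,
      durrmeyer φ ψ 1 (fun u => (u - x) ^ n) x = if n = 0 then 1 else 0 := by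
    intro x n hn
    have hn' : (n : ℝ) ≤ r := by exact_mod_cast hn.le
    rw [durrmeyer_pow hψm (by linarith) hA₁' hA₂']
    rcases Nat.eq_zero_or_pos n with rfl | h0
    · simp [hφ.moment_zero, hψ.moment_zero]
    · rw [if_neg h0.ne']
      exact hii n h0 hn x
  obtain ⟨K, hK, hKf⟩ := exists_eLpNorm_durrmeyer_one_sub_le hp hp' hr hθ hB0 hψm hA₂' hB hmom
  exact ⟨fun f hf => wellDefinedOn_of_decay hp hp' (by linarith) hB0 hφm hψm hA₂' hB hf,
    fun β f hf => hf.hasRate hp' hK hφm hKf⟩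

theorem decaysWithOrder_of_hasCompactSupport (h : HasCompactSupport ψ) (θ : ℝ) :
    DecaysWithOrder ψ θ := by
  rw [DecaysWithOrder, ← coclosedCompact_eq_cocompact]
  exact (hasCompactSupport_iff_eventuallyEq.1 h).trans_isBigO (Asymptotics.isBigO_zero _ _)

end Conclusion

end Durrmeyer

theorem mainTheorem6 (r : ℕ) (hr : 1 < r) (φ ψ : ℝ → ℝ)
    (hφ : Durrmeyer.IsDiscreteKernel φ) (hψ : Durrmeyer.IsContinuousKernel ψ)
    (hψM : Durrmeyer.absMomentZero ψ < ⊤)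
    (hi : Durrmeyer.ConstantMoments φ r) (hii : Durrmeyer.VanishingMoments φ ψ r) :
    (∀ p : ℝ, 1 < p →
      (∃ θ : ℝ, p * r + 1 < θ ∧ Durrmeyer.DecaysWithOrder φ θ) →
      (∃ θ : ℝ, p * r + 1 < θ ∧ Durrmeyer.DecaysWithOrder ψ θ) →
      (∀ f : ℝ → ℝ, MemLp f (ENNReal.ofReal p) volume →
        Durrmeyer.WellDefinedOn φ ψ (ENNReal.ofReal p) f) ∧
      (∀ (α : ℝ) (f : ℝ → ℝ), 0 < α → α < r →
        Durrmeyer.MemLipStar α (ENNReal.ofReal p) f →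
        Durrmeyer.HasRate φ ψ (ENNReal.ofReal p) α f) ∧
      (∀ f : ℝ → ℝ, Durrmeyer.MemLip (r - 1) 1 (ENNReal.ofReal p) f ∨
          Durrmeyer.MemSobolev r (ENNReal.ofReal p) f →
        Durrmeyer.HasRate φ ψ (ENNReal.ofReal p) r f)) ∧
    ((∃ θ : ℝ, (r : ℝ) + 1 < θ ∧ Durrmeyer.DecaysWithOrder φ θ) →
      HasCompactSupport ψ →
      (∀ f : ℝ → ℝ, MemLp f 1 volume → Durrmeyer.WellDefinedOn φ ψ 1 f) ∧
      (∀ (α : ℝ) (f : ℝ → ℝ), 0 < α → α < r →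
        Durrmeyer.MemLipStar α 1 f → Durrmeyer.HasRate φ ψ 1 α f) ∧
      (∀ f : ℝ → ℝ, Durrmeyer.MemLip (r - 1) 1 1 f ∨
          (Durrmeyer.MemSobolevBV (r - 1) f ∧ MemLp f 1 volume) →
        Durrmeyer.HasRate φ ψ 1 r f)) := by
  have hr1 : r - 1 + 1 = r := by omega
  constructor
  · rintro p hp ⟨θ₁, hθ₁, hφd⟩ ⟨θ₂, hθ₂, hψd⟩
    have hpr : (r : ℝ) ≤ p * r := le_mul_of_one_le_left r.cast_nonneg hp.le
    have h1 : 1 ≤ ENNReal.ofReal p := by simpa using hp.le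
    have htop : ENNReal.ofReal p ≠ ⊤ := ENNReal.ofReal_ne_top
    obtain ⟨hwd, hrate⟩ := Durrmeyer.wellDefinedOn_and_hasRate h1 htop hr.le hφ hψ hψM hii
      (by linarith) (by linarith) hφd hψd
    refine ⟨hwd, fun α f h0 hα hf => hrate α f (hf.modulusBigO h1 h0 hα), ?_⟩
    rintro f (hf | hf)
    · exact hrate r f (by simpa only [hr1] using hf.modulusBigO h1 htop)
    · exact hrate r f (hf.modulusBigO h1 htop)
  · rintro ⟨θ, hθ, hφd⟩ hsupp
    obtain ⟨hwd, hrate⟩ := Durrmeyer.wellDefinedOn_and_hasRate le_rfl ENNReal.one_ne_top hr.le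
      hφ hψ hψM hii hθ hθ hφd (Durrmeyer.decaysWithOrder_of_hasCompactSupport hsupp θ)
    refine ⟨hwd, fun α f h0 hα hf => hrate α f (hf.modulusBigO le_rfl h0 hα), ?_⟩
    rintro f (hf | ⟨hf, hf1⟩)
    · exact hrate r f (by simpa only [hr1] using hf.modulusBigO le_rfl ENNReal.one_ne_top)
    · exact hrate r f (by simpa only [hr1] using hf.modulusBigO hf1)
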